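/- Let $n\ge 2$, let $\Gamma$ be the cyclic quiver with vertex set $\mathbf Z/n\mathbf Z$ and arrows $i\to i-1$, and let $\mathbf N^*=\{1,2,\dots\}$. A multisegment is a formal finite sum $\mathbf m=\sum_{\ell\in\mathbf N^*,\,i\in\mathbf Z/n\mathbf Z} m_{(\ell;i]}\,(\ell;i]$ with $m_{(\ell;i]}\in\mathbf N$. For a field $\mathbf k$ put $\mathbf k[\mathbf m]=\bigoplus_{\ell,i}\mathbf k[\ell;i]^{\oplus m_{(\ell;i]}}$, where $\mathbf k[\ell;i]$ is the indecomposable nilpotent representation of $\Gamma$ of length $\ell$ whose head is the simple representation at the vertex $i$; these are the nilpotent representations of $\Gamma$ up to isomorphism. Let $\dim\mathbf m\in\mathbf N^{\mathbf Z/n\mathbf Z}$ be the graded dimension of $\mathbf k[\mathbf m]$, and let $\dim O_{\mathbf m}$ be the dimension of the orbit $O_{\mathbf m}$ of $\mathbf C[\mathbf m]=V=\bigoplus_j V_j$ in $\bigoplus_j\mathrm{Hom}(V_j,V_{j-1})$ under $\prod_j GL(V_j)$. Let $F^{\mathbf q}_{\mathbf o,\mathbf p}\in\mathbf Z[t]$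 be the Hall polynomial: for every finite field $\mathbf k$, $F^{\mathbf q}_{\mathbf o,\mathbf p}(|\mathbf k|)$ is the number of submodules $N$ of $\mathbf k[\mathbf q]$ with $N\cong\mathbf k[\mathbf p]$ and $\mathbf k[\mathbf q]/N\cong\mathbf k[\mathbf o]$. The twisted Hall algebra $\mathcal H$ is the $\mathbf C(v)$-algebra with basis $\{u_{\mathbf m}\}$ and multiplication $$u_{\mathbf o}\circ u_{\mathbf p}=v^{m(\dim\mathbf o,\dim\mathbf p)}\sum_{\mathbf q} F^{\mathbf q}_{\mathbf o,\mathbf p}(v^{-2})\,u_{\mathbf q},\qquad m(\mathbf a,\mathbf b)=\sum_i a_ib_{i-1}+\sum_i a_ib_i,$$ where $\mathbf q$ runs over the multisegments with $\dim\mathbf q=\dim\mathbf o+\dim\mathbf p$. Its PBW basis consists of the elements $\langle\mathbf m\rangle=v^{\dim O_{\mathbf m}}u_{\mathbf m}$. The Chevalley generator $f_i$ of $U_v^-(\widehat{\mathfrak{sl}}_n)$ acts on $\mathcal H$ as left multiplication by $\langle O_i\rangle=\langle(1;i]\rangle$, the element attached to the simple representation at $i$. For $\ell\in\mathbf N^*$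 and $i\in\mathbf Z/n\mathbf Z$ put $\mathbf m^+_{1,i}=\mathbf m+(1;i]$ and, if $\ell>1$ and $m_{(\ell-1;i-1]}\ne0$, $\mathbf m^+_{\ell,i}=\mathbf m+(\ell;i]-(\ell-1;i-1]$; if $\ell>1$ and $m_{(\ell-1;i-1]}=0$, put $\langle\mathbf m^+_{\ell,i}\rangle=0$. For $a\in\mathbf Z$ let $[a]=(v^a-v^{-a})/(v-v^{-1})$. **Proposition.** For every $i\in\mathbf Z/n\mathbf Z$ and every multisegment $\mathbf m$, $$f_i\,\langle\mathbf m\rangle=\sum_{\ell\in\mathbf N^*} v^{\,\sum_{k>\ell}(m_{(k-1;i-1]}-m_{(k;i]})}\,[m_{(\ell;i]}+1]\,\langle\mathbf m^+_{\ell,i}\rangle .$$ -/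

import Mathlib

open scoped Polynomial

noncomputable section

namespace CyclicHall

/-! ## Multisegments over the cyclic set of residues modulo `n` -/

/-- The pair `(ℓ, i)` stands for the segment `(ℓ;i] = [i-ℓ+1, …, i]` of length `ℓ ≥ 1` ending in
`i`. -/
abbrev Segment (n : ℕ) : Type := ℕ+ × ZMod n

/-- A multisegment: `m (ℓ, i)` is the multiplicity `m_{(ℓ;i]}`. -/
abbrev Multisegment (n : ℕ) : Type := Segment n →₀ ℕ

/-! ## Representations of the cyclic quiver with arrows `j → j - 1` -/

/-- A representation over `k` of the quiver with vertex set `ZMod n` and one arrow `j → j - 1` for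
each vertex `j`. -/
structure Rep (n : ℕ) (k : Type) [Field k] where
  V : ZMod n → Type
  [addCommGroup : ∀ j, AddCommGroup (V j)]
  [module : ∀ j, Module k (V j)]
  x : ∀ j, V j →ₗ[k] V (j - 1)

attribute [instance] Rep.addCommGroup Rep.module

/-- Two representations are isomorphic. -/
def Rep.Iso {n : ℕ} {k : Type} [Field k] (M N : Rep n k) : Prop :=
  ∃ e : ∀ j, M.V j ≃ₗ[k] N.V j, ∀ j (w : M.V j), e (j - 1) (M.x j w) = N.x j (e j w)

/-- A submodule (subrepresentation) of `M`. -/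
structure Subrep {n : ℕ} {k : Type} [Field k] (M : Rep n k) where
  carrier : ∀ j, Submodule k (M.V j)
  map_mem : ∀ j, ∀ w ∈ carrier j, M.x j w ∈ carrier (j - 1)

/-- A submodule, as a representation. -/
def Subrep.toRep {n : ℕ} {k : Type} [Field k] {M : Rep n k} (N : Subrep M) : Rep n k where
  V j := N.carrier j
  x j := (M.x j).restrict (N.map_mem j)

/-- The quotient representation `M / N`. -/
def Subrep.quotient {n : ℕ} {k : Type} [Field k] {M : Rep n k} (N : Subrep M) : Rep n k where
  V j := M.V j ⧸ N.carrier j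
  x j := (N.carrier j).mapQ (N.carrier (j - 1)) (M.x j) (N.map_mem j)

/-- The individual segments occurring in `m`, each repeated according to its multiplicity. -/
abbrev Copy {n : ℕ} (m : Multisegment n) : Type := Σ s : m.support, Fin (m s)

/-- The basis vectors of `k[m]` at the vertex `j`.  A segment `(ℓ;i]` has `ℓ` basis vectors, in
positions `c = 0, …, ℓ - 1`; the one in position `c` sits at the vertex `i - c`.  So position `0`
is the head. -/
abbrev Cell {n : ℕ} (m : Multisegment n) (j : ZMod n) : Type :=
  Σ p : Copy m, {c : Fin (p.1.1.1 : ℕ) // p.1.1.2 - ((c : ℕ) : ZMod n) = j}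

/-- The matrix of `V_j → V_{j-1}` in `k[m]`: the basis vector in position `c` of a segment is
mapped to the one in position `c + 1` of the same segment, and to `0` if there is none. -/
def shift {n : ℕ} (k : Type) [Field k] (m : Multisegment n) (j : ZMod n) :
    Matrix (Cell m (j - 1)) (Cell m j) k :=
  Matrix.of fun b a => if b.1 = a.1 ∧ (b.2.1 : ℕ) = (a.2.1 : ℕ) + 1 then 1 else 0

/-- The nilpotent representation `k[m] = ⨁ k[ℓ;i]^{m_{(ℓ;i]}}`, where `k[ℓ;i]` is the
indecomposable module of length `ℓ` with head at the vertex `i`.  The isomorphism classes of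
finite-dimensional nilpotent representations, over any field, are labelled by the multisegments
in this way. -/
def stdRep {n : ℕ} (k : Type) [Field k] (m : Multisegment n) : Rep n k where
  V j := Cell m j → k
  x j := (shift k m j).mulVecLin

/-- The graded dimension of `k[m]`. -/
def dimVec {n : ℕ} (m : Multisegment n) (j : ZMod n) : ℕ := Fintype.card (Cell m j)

/-! ## Hall polynomials -/

/-- The number of submodules of `k[q]` of type `p` and cotype `o`, i.e. isomorphic to `k[p]` and
with quotient isomorphic to `k[o]`. -/
def hallCount {n : ℕ} (k : Type) [Field k] (o p q : Multisegment n) : ℕ :=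
  Nat.card {N : Subrep (stdRep k q) //
    N.toRep.Iso (stdRep k p) ∧ N.quotient.Iso (stdRep k o)}

/-- `F` is the Hall polynomial for `o, p, q`: its value at the cardinality of any finite field `k`
is the number of submodules of `k[q]` of type `p` and cotype `o`. -/
def IsHallPoly {n : ℕ} (o p q : Multisegment n) (F : ℤ[X]) : Prop :=
  ∀ (k : Type) [Field k] [Finite k], F.eval (Nat.card k : ℤ) = (hallCount k o p q : ℤ)

theorem IsHallPoly.unique {n : ℕ} {o p q : Multisegment n} {F G : ℤ[X]}
    (hF : IsHallPoly o p q F) (hG : IsHallPoly o p q G) : F = G := by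
  apply Polynomial.eq_of_infinite_eval_eq
  have h : (Nat.cast '' {p : ℕ | p.Prime} : Set ℤ).Infinite :=
    Nat.infinite_setOfPred_prime.image (fun _ _ _ _ hab => by exact_mod_cast hab)
  refine h.mono ?_
  rintro _ ⟨r, hr, rfl⟩
  have : Fact r.Prime := ⟨hr⟩
  have h1 := hF (ZMod r)
  have h2 := hG (ZMod r)
  rw [Nat.card_zmod] at h1 h2
  exact h1.trans h2.symm

open scoped Classical in
/-- The Hall polynomial `F^q_{o,p}`.  It is unique by `IsHallPoly.unique`. -/
def hallPoly {n : ℕ} (o p q : Multisegment n) : ℤ[X] :=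
  if h : ∃ F, IsHallPoly o p q F then h.choose else 0

/-! ## Finiteness of the set of multisegments of a given dimension -/

theorem mul_le_sum_dimVec {n : ℕ} [NeZero n] (m : Multisegment n) (s : Segment n) :
    m s * (s.1 : ℕ) ≤ ∑ j, dimVec m j := by
  by_cases hs : s ∈ m.support
  · have h : Fintype.card (Fin (m s) × Fin (s.1 : ℕ)) ≤ Fintype.card (Σ j, Cell m j) := by
      refine Fintype.card_le_of_injective
        (fun y => ⟨s.2 - ((y.2 : ℕ) : ZMod n), ⟨⟨⟨s, hs⟩, y.1⟩, ⟨y.2, rfl⟩⟩⟩) ?_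
      rintro ⟨a, c⟩ ⟨a', c'⟩ h
      let F : (Σ j, Cell m j) → ℕ × ℕ := fun z => ((z.2.1.2 : ℕ), (z.2.2.1 : ℕ))
      have := congrArg F h
      simp only [F, Prod.mk.injEq] at this
      exact Prod.ext (Fin.ext this.1) (Fin.ext this.2)
    simpa [Fintype.card_sigma, dimVec] using h
  · simp [Finsupp.notMem_support_iff.mp hs]

theorem finite_dimVec_eq {n : ℕ} [NeZero n] (d : ZMod n → ℕ) :
    {m : Multisegment n | dimVec m = d}.Finite := by
  set N : ℕ := ∑ j, d j with hN
  have hfin : {s : Segment n | (s.1 : ℕ) ≤ N}.Finite := by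
    have : {s : Segment n | (s.1 : ℕ) ≤ N} = {l : ℕ+ | (l : ℕ) ≤ N} ×ˢ Set.univ := by
      ext s; simp
    rw [this]
    refine Set.Finite.prod ?_ Set.finite_univ
    exact Set.Finite.preimage (PNat.coe_injective.injOn) (Set.finite_Iic N)
  let M : Multisegment n := Finsupp.indicator hfin.toFinset (fun _ _ => N)
  refine (Set.finite_Icc (0 : Multisegment n) M).subset ?_
  intro m hm
  refine ⟨zero_le, ?_⟩
  intro s
  have h := mul_le_sum_dimVec m s
  rw [show dimVec m = d from hm, ← hN] at h
  by_cases hs : m s = 0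
  · simp [hs]
  · have h1 : (s.1 : ℕ) ≤ N := (Nat.le_mul_of_pos_left _ (Nat.pos_of_ne_zero hs)).trans h
    have h2 : m s ≤ N := (Nat.le_mul_of_pos_right _ s.1.pos).trans h
    have h3 : s ∈ hfin.toFinset := by simpa using h1
    simpa [M, Finsupp.indicator_of_mem h3] using h2

/-! ## The generic twisted Hall algebra -/

/-- The element `v` of the field `ℂ(v)`. -/
abbrev v : RatFunc ℂ := RatFunc.X

/-- The `v`-integer `[a] = (v^a - v^{-a}) / (v - v^{-1})`. -/
def vInt (a : ℤ) : RatFunc ℂ := (v ^ a - v ^ (-a)) / (v - v⁻¹)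

/-- The bilinear form `m(a, b) = ∑_{i → j} a_i b_j + ∑_i a_i b_i`. -/
def mForm {n : ℕ} [NeZero n] (a b : ZMod n → ℕ) : ℕ :=
  ∑ i, a i * b (i - 1) + ∑ i, a i * b i

/-- The underlying vector space of the twisted Hall algebra: the `ℂ(v)`-vector space with basis
`u_m`, where the multisegment `m` labels the isomorphism class of `k[m]`. -/
abbrev Hall (n : ℕ) : Type := Multisegment n →₀ RatFunc ℂ

/-- The basis element `u_m`. -/
def u {n : ℕ} (m : Multisegment n) : Hall n := Finsupp.single m 1

/-- The product of basis elements,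
`u_o ∘ u_p = v^{m(dim o, dim p)} ∑_q F^q_{o,p}(v^{-2}) u_q`, the sum being over all `q` with
`dim q = dim o + dim p`. -/
def basisMul {n : ℕ} [NeZero n] (o p : Multisegment n) : Hall n :=
  v ^ mForm (dimVec o) (dimVec p) •
    ∑ q ∈ (finite_dimVec_eq (dimVec o + dimVec p)).toFinset,
      Polynomial.aeval ((v ^ 2)⁻¹) (hallPoly o p q) • u q

/-- The multiplication of the twisted Hall algebra: the bilinear extension of `basisMul`. -/
def hallMul {n : ℕ} [NeZero n] : Hall n →ₗ[RatFunc ℂ] Hall n →ₗ[RatFunc ℂ] Hall n :=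
  Finsupp.linearCombination (RatFunc ℂ)
    (fun o => Finsupp.linearCombination (RatFunc ℂ) (fun p => basisMul o p))

/-! ## Orbits and the PBW basis -/

/-- Coordinates on the space `E_V = ⨁_j Hom(V_j, V_{j-1})`, for `V` the graded vector space
underlying `ℂ[m]`: the entries of the matrices of the maps `V_j → V_{j-1}`. -/
abbrev Coord {n : ℕ} (m : Multisegment n) : Type := Σ j : ZMod n, Cell m (j - 1) × Cell m j

/-- The orbit `O_m` of `ℂ[m]` in `E_V` under `G_V = ∏_j GL(V_j)`, which acts by conjugation. -/
def orbit {n : ℕ} (m : Multisegment n) : Set (Coord m → ℂ) :=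
  Set.range fun (g : ∀ j, GL (Cell m j) ℂ) (c : Coord m) =>
    ((g (c.1 - 1)).val * shift ℂ m c.1 * ((g c.1)⁻¹).val : Matrix _ _ ℂ) c.2.1 c.2.2

/-- The dimension of the orbit `O_m` as an algebraic variety: the transcendence degree over `ℂ` of
the coordinate ring of its Zariski closure. -/
def orbitDim {n : ℕ} (m : Multisegment n) : ℕ :=
  Cardinal.toNat
    (Algebra.trdeg ℂ (MvPolynomial (Coord m) ℂ ⧸ MvPolynomial.vanishingIdeal ℂ (orbit m)))

/-- The element `⟨m⟩ = v^{dim O_m} u_m` of the PBW basis. -/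
def pbw {n : ℕ} (m : Multisegment n) : Hall n := v ^ orbitDim m • u m

/-! ## Chevalley generators -/

/-- The action of the Chevalley generator `f_i` on the Hall algebra.  The isomorphism of the
negative part of the quantum affine algebra with the composition algebra maps `f_i` to `⟨O_i⟩`,
where `O_i` is the orbit of the simple module `k[i]`, so that `f_i` acts as left multiplication by
`⟨O_i⟩`. -/
def chevalleyF {n : ℕ} [NeZero n] (i : ZMod n) : Hall n →ₗ[RatFunc ℂ] Hall n :=
  hallMul (pbw (Finsupp.single (1, i) 1))

/-- The element `⟨m⁺_{ℓ,i}⟩`, where `m⁺_{1,i} = m + (1;i]` and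
`m⁺_{ℓ,i} = m + (ℓ;i] - (ℓ-1;i-1]` for `ℓ > 1`; by convention it is `0` if `ℓ > 1` and
`m_{(ℓ-1;i-1]} = 0`. -/
def pbwPlus {n : ℕ} (m : Multisegment n) (l : ℕ+) (i : ZMod n) : Hall n :=
  if l = 1 then pbw (m + Finsupp.single (1, i) 1)
  else if m (l - 1, i - 1) = 0 then 0
  else pbw (m + Finsupp.single (l, i) 1 - Finsupp.single (l - 1, i - 1) 1)

/-- The exponent `∑_{k > ℓ} (m_{(k-1;i-1]} - m_{(k;i]})`. -/
def exponent {n : ℕ} (m : Multisegment n) (l : ℕ+) (i : ZMod n) : ℤ :=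
  ∑ᶠ k ∈ Set.Ioi l, ((m (k - 1, i - 1) : ℤ) - (m (k, i) : ℤ))

theorem finite_apply_ne_zero {n : ℕ} (m : Multisegment n) (i : ZMod n) :
    {k : ℕ+ | m (k, i) ≠ 0}.Finite := by
  refine (Set.Finite.image Prod.fst m.hasFiniteSupport).subset ?_
  intro k hk
  exact ⟨(k, i), hk, rfl⟩

theorem finite_apply_pred_ne_zero {n : ℕ} (m : Multisegment n) (i : ZMod n) :
    {k : ℕ+ | 1 < k ∧ m (k - 1, i) ≠ 0}.Finite := by
  refine (Set.Finite.image (fun k => k + 1) (finite_apply_ne_zero m i)).subset ?_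
  rintro k ⟨h1, hk⟩
  exact ⟨k - 1, hk, PNat.sub_add_of_lt h1⟩

/-- Only finitely many terms of the sum defining `exponent` are nonzero. -/
theorem exponent_finite {n : ℕ} (m : Multisegment n) (l : ℕ+) (i : ZMod n) :
    (Set.Ioi l ∩ Function.support
      fun k : ℕ+ => (m (k - 1, i - 1) : ℤ) - (m (k, i) : ℤ)).Finite := by
  refine ((finite_apply_pred_ne_zero m (i - 1)).union (finite_apply_ne_zero m i)).subset ?_
  rintro k ⟨hk, hne⟩
  by_contra hcon
  simp only [Set.mem_union, Set.mem_ofPred_eq, not_or, not_and, not_not] at hcon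
  apply hne
  simp [hcon.2, hcon.1 (lt_of_le_of_lt one_le hk)]

/-- Only finitely many of the elements `⟨m⁺_{ℓ,i}⟩` are nonzero. -/
theorem pbwPlus_finite {n : ℕ} (m : Multisegment n) (i : ZMod n) :
    (Function.support fun l : ℕ+ => pbwPlus m l i).Finite := by
  refine ((finite_apply_pred_ne_zero m (i - 1)).union (Set.finite_singleton 1)).subset ?_
  intro l hl
  by_cases h1 : l = 1
  · exact Or.inr h1
  · refine Or.inl ⟨lt_of_le_of_ne one_le (Ne.symm h1), fun h0 => hl ?_⟩
    simp [pbwPlus, h1, h0]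

end CyclicHall

end

/-!
The class `⟨O_i⟩` is that of a simple module, so the coefficient of `u_q` in `f_i ⟨m⟩` counts the
submodules `N ≅ k[m]` of `k[q]` with simple quotient at the vertex `i`.  As the quiver has no loops,
such an `N` is the kernel of a linear form `φ ≠ 0` on the part of the head of `k[q]` at `i`, which
has one coordinate for each segment of `q` with head at `i`; `N` determines `φ` up to scalars
(`exists_eq_headSub`, `eq_smul_of_headSub_eq`).  If the shortest segment on which `φ` does not
vanish has length `l`, adding multiples of that segment to the longer ones shows that `N` is
obtained from `k[q]` by deleting the head of one segment `(l;i]` (`headSub_iso`).  As the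
`k[m]` are pairwise non-isomorphic (`eq_of_stdRep_iso`), `q` occurs in `f_i ⟨m⟩` if and only if it
arises from `m` by lengthening a segment `(l-1;i-1]` to `(l;i]`, or by adding `(1;i]` (the relation
`Extends`), and then the Hall polynomial is `t ^ B * (1 + t + ⋯ + t ^ (q (l;i] - 1))`, where `B` is
the number of segments `(k;i]` of `q` with `k > l` (`Extends.hallPoly_eq`).  At `t = v⁻²` the
second factor is the quantum integer `[q (l;i]] = [m (l;i] + 1]`, up to a power of `v`.

It remains to compare the powers of `v`, that is, to compute `dim O_q - dim O_m`.  The dimension of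
an orbit is defined here as the transcendence degree of the coordinate ring of its Zariski closure.
That ring is generated by the coordinates `X` of the generic point `g x g⁻¹` of the orbit, so its
fraction field is `F = ℂ(X)`.  The generic matrix `g` lies in the space `W` of solutions `y` of the
linear equations `y x = X y`, which are defined over `F`.  A point of `W` is determined over `F` by
`dim W` of its coordinates, so `trdeg F ≥ dim G - dim W`.  Conversely, a general point of `W` still
generates a field containing `F`, and there is one for which these `dim W` coordinates are
constants, so `trdeg F ≤ dim G - dim W` (`trdeg_add_finrank_eq_card`).  Since
`W = g · End(k[m])`, this is the orbit-stabilizer formula `dim O_m = dim G - dim End(k[m])`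
(`orbitDim_add_finrank_commutant`).  Finally `dim End(k[m])` is the number of pairs of segments,
with a position in the second, that admit a homomorphism sending the head of the first to that
position (`finrank_commutant`, `card_homIdx`), and a recursion on the lengths computes its change
under lengthening a segment (`Extends.orbitDim_eq`).
-/

noncomputable section

namespace CyclicHall

/-! ### Transcendence degree of a field of definition -/

open Algebra IntermediateField.algebraAdjoinAdjoin in
/-- Passing from the algebra generated by a set to the field it generates does not change the
transcendence degree. -/
theorem trdeg_intermediateField_adjoin {k L : Type} [Field k] [Field L] [Algebra k L] (s : Set L) :
    trdeg k (IntermediateField.adjoin k s) = trdeg k (Algebra.adjoin k s) := by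
  rw [← _root_.trdeg_add_eq k (adjoin k s) (A := IntermediateField.adjoin k s),
    trdeg_eq_zero (R := adjoin k s), add_zero]

open Algebra in
theorem trdeg_intermediateField_adjoin_le {k L : Type} [Field k] [Field L] [Algebra k L]
    {κ : Type} (w : κ → L) :
    trdeg k (IntermediateField.adjoin k (Set.range w)) ≤ Cardinal.mk κ := by
  rw [trdeg_intermediateField_adjoin, adjoin_range_eq_range_aeval]
  refine (trdeg_le_of_surjective (MvPolynomial.aeval (R := k) w).rangeRestrict
    (AlgHom.rangeRestrict_surjective _)).trans ?_
  rw [MvPolynomial.trdeg_of_isDomain, Cardinal.lift_id]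

/-- A linear system with coefficients in a subfield `F` that is solvable over `L` is solvable
over `F`. -/
theorem exists_solution_of_exists_solution_extension {F L : Type} [Field F] [Field L] [Algebra F L]
    {σ ι : Type} [Fintype σ] (A : ι → σ → F) (b : ι → F) (y : σ → L)
    (hy : ∀ r, ∑ s, algebraMap F L (A r s) * y s = algebraMap F L (b r)) :
    ∃ z : σ → F, ∀ r, ∑ s, A r s * z s = b r := by
  obtain ⟨ρ, hρ⟩ := LinearMap.exists_leftInverse_of_injective (Algebra.linearMap F L)
    (LinearMap.ker_eq_bot.mpr (algebraMap F L).injective)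
  have hρ' (a : F) : ρ (algebraMap F L a) = a := LinearMap.congr_fun hρ a
  refine ⟨fun s => ρ (y s), fun r => ?_⟩
  have := congrArg ρ (hy r)
  simpa [← Algebra.smul_def, hρ'] using this

set_option maxHeartbeats 800000 in
/-- Let `W` be a space of solutions in `L` of a linear system over the subfield `F`, and let `g` be
a point of `W` whose coordinates are a transcendence basis of `L = k(g)` over `k`.  If all the
points `w ∈ W` off the hypersurface `P = 0` have the property that their coordinates generate a
field containing `F`, then `trdeg F = |I| - dim W`. -/
theorem trdeg_add_finrank_eq_card {k L : Type} [Field k] [Field L] [Algebra k L] [Infinite k]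
    {I ρ : Type} [Fintype I] [Finite ρ] (F : IntermediateField k L) (B : ρ → I → F)
    (W : Submodule L (I → L))
    (hW : ∀ y, y ∈ W ↔ ∀ r, ∑ i, (B r i : L) * y i = 0)
    (g : I → L) (hg : IsTranscendenceBasis k g)
    (htop : IntermediateField.adjoin k (Set.range g) = ⊤) (hgW : g ∈ W)
    (P : MvPolynomial I k) (hP : MvPolynomial.aeval g P ≠ 0)
    (hF : ∀ w ∈ W, MvPolynomial.aeval w P ≠ 0 → F ≤ IntermediateField.adjoin k (Set.range w)) :
    Algebra.trdeg k F + (Module.finrank L W : Cardinal) = (Fintype.card I : Cardinal) := by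
  classical
  have : Fintype ρ := Fintype.ofFinite ρ
  -- A set of pivots: coordinates that restrict to a basis of the dual of `W`.
  let π (i : I) : Module.Dual L W := (LinearMap.proj i).comp W.subtype
  have hπ (i : I) (w : W) : π i w = w.1 i := rfl
  obtain ⟨κ, a, ha, hspan, hli⟩ := exists_linearIndependent' L π
  have : Finite κ := Finite.of_injective a ha
  have : Fintype κ := Fintype.ofFinite κ
  have hspan' : Submodule.span L (Set.range π) = ⊤ := by
    refine Submodule.eq_top_iff'.mpr fun f => mem_span_of_iInf_ker_le_ker fun w hw => ?_
    have : w = 0 := Subtype.ext (funext fun i => (Submodule.mem_iInf _).mp hw i)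
    simp [this]
  have hcard : Fintype.card κ = Module.finrank L W := by
    rw [← Subspace.dual_finrank_eq, ← finrank_span_eq_card hli, hspan, hspan', finrank_top]
  let ev : W →ₗ[L] κ → L := LinearMap.pi fun c => π (a c)
  have hev : Function.Injective ev := by
    refine (injective_iff_map_eq_zero ev).mpr fun w hw => Subtype.ext (funext fun i => ?_)
    have hi : π i ∈ Submodule.span L (Set.range (π ∘ a)) := hspan ▸ hspan' ▸ Submodule.mem_top
    refine Submodule.span_induction (p := fun f _ => f w = 0) ?_ rfl ?_ ?_ hi
    · rintro _ ⟨c, rfl⟩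
      exact congrFun hw c
    · intro f f' _ _ h h'; simp [h, h']
    · intro c f _ h; simp [h]
  let θ : W ≃ₗ[L] κ → L := LinearEquiv.ofInjectiveOfFinrankEq ev hev (by simp [hcard])
  have hθ (w : W) (c : κ) : θ w c = w.1 (a c) := rfl
  refine le_antisymm ?_ ?_
  · -- A point of `W` with pivot coordinates in `k` still generates a field containing `F`.
    let coord (i : I) : MvPolynomial κ L :=
      ∑ c, MvPolynomial.C ((θ.symm (Pi.single c 1)).1 i) * MvPolynomial.X c
    have hcoord (z : κ → L) (i : I) : MvPolynomial.eval z (coord i) = (θ.symm z).1 i := by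
      have hz : z = ∑ c, z c • (Pi.single c 1 : κ → L) := by
        simpa using (pi_eq_sum_univ' z)
      conv_rhs => rw [hz]
      simp [coord, mul_comm]
    let p : MvPolynomial κ L := MvPolynomial.aeval coord P
    have hp (z : κ → L) : MvPolynomial.eval z p = MvPolynomial.aeval (θ.symm z).1 P := by
      have := MvPolynomial.map_aeval coord (MvPolynomial.eval z) P
      simp only [hcoord] at this
      rw [MvPolynomial.aeval_def, show algebraMap k L =
        (MvPolynomial.eval z).comp (algebraMap k (MvPolynomial κ L)) from ?_]
      · exact this
      · ext x
        rw [RingHom.comp_apply, IsScalarTower.algebraMap_apply k L (MvPolynomial κ L),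
          MvPolynomial.algebraMap_eq, MvPolynomial.eval_C]
    have hp0 : p ≠ 0 := by
      intro h
      apply hP
      have := hp (θ ⟨g, hgW⟩)
      rw [h, map_zero, LinearEquiv.symm_apply_apply] at this
      exact this.symm
    obtain ⟨z, hz⟩ : ∃ z : κ → k, MvPolynomial.eval (fun c => algebraMap k L (z c)) p ≠ 0 := by
      by_contra! h
      refine hp0 (MvPolynomial.funext_set (fun _ => Set.range (algebraMap k L))
        (fun _ => Set.infinite_range_of_injective (algebraMap k L).injective) fun x hx => ?_)
      choose z hz using fun c => hx c (Set.mem_univ c)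
      rw [map_zero, ← h z]
      simp only [hz]
    rw [hp] at hz
    set w := θ.symm (fun c => algebraMap k L (z c)) with hw
    have hFw := hF w.1 w.2 hz
    have hwa (c : κ) : w.1 (a c) = algebraMap k L (z c) := by
      rw [← hθ, hw, LinearEquiv.apply_symm_apply]
    have hle : F ≤ IntermediateField.adjoin k
        (Set.range fun i : {i // i ∉ Set.range a} => w.1 i) := by
      refine hFw.trans (IntermediateField.adjoin_le_iff.mpr ?_)
      rintro _ ⟨i, rfl⟩
      by_cases hi : i ∈ Set.range a
      · obtain ⟨c, rfl⟩ := hi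
        rw [hwa]
        exact IntermediateField.algebraMap_mem _ _
      · exact IntermediateField.subset_adjoin _ _ ⟨⟨i, hi⟩, rfl⟩
    have h1 := (trdeg_le_of_injective (IntermediateField.inclusion hle)
      (IntermediateField.inclusion_injective hle)).trans
      (trdeg_intermediateField_adjoin_le (k := k) _)
    have h2 : Fintype.card {i // i ∉ Set.range a} + Fintype.card κ = Fintype.card I := by
      have hr : Fintype.card {i // i ∈ Set.range a} = Fintype.card κ :=
        Set.card_range_of_injective ha
      have := Fintype.card_subtype_compl (fun i => i ∈ Set.range a)
      have := Fintype.card_subtype_le (fun i => i ∈ Set.range a)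
      omega
    rw [← h2, Nat.cast_add, hcard]
    gcongr
    simpa using h1
  · -- The coordinates of `g` are combinations over `F` of its pivot coordinates.
    have key (i : I) : ∃ z : κ ⊕ ρ → F, ∀ j : I,
        ∑ s, (Sum.elim (fun c => if a c = j then 1 else 0) (fun r => B r j) s) * z s =
          if i = j then 1 else 0 := by
      have hi : π i ∈ Submodule.span L (Set.range (π ∘ a)) := hspan ▸ hspan' ▸ Submodule.mem_top
      obtain ⟨c, hc⟩ := (Submodule.mem_span_range_iff_exists_fun L).mp hi
      let f : Module.Dual L (I → L) := LinearMap.proj i - ∑ s, c s • LinearMap.proj (a s)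
      let R (r : ρ) : Module.Dual L (I → L) := ∑ j, (B r j : L) • LinearMap.proj j
      have hf : f ∈ Submodule.span L (Set.range R) := by
        refine mem_span_of_iInf_ker_le_ker fun y hy => ?_
        have hyW : y ∈ W := (hW y).mpr fun r => by
          simpa [R] using (Submodule.mem_iInf _).mp hy r
        have := LinearMap.congr_fun hc ⟨y, hyW⟩
        simp [hπ] at this
        simp [f, this]
      obtain ⟨d, hd⟩ := (Submodule.mem_span_range_iff_exists_fun L).mp hf
      refine exists_solution_of_exists_solution_extension _ _ (Sum.elim c d) fun j => ?_
      have h1 := LinearMap.congr_fun hd (Pi.single j 1)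
      simp [f, R, Pi.single_apply] at h1
      rw [eq_sub_iff_add_eq] at h1
      rw [apply_ite (algebraMap F L), map_one, map_zero, ← h1]
      simp [mul_comm, add_comm, apply_ite (Subtype.val : F → L)]
    have htop' : IntermediateField.adjoin F (Set.range fun c => g (a c)) = ⊤ := by
      refine IntermediateField.restrictScalars_injective k ?_
      rw [IntermediateField.restrictScalars_top, eq_top_iff, ← htop,
        IntermediateField.adjoin_le_iff]
      rintro _ ⟨i, rfl⟩
      obtain ⟨z, hz⟩ := key i
      have hgi : g i = ∑ c, (z (Sum.inl c) : L) * g (a c) := by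
        have hB (r : ρ) : (z (Sum.inr r) : L) * ∑ j, (B r j : L) * g j = 0 := by
          rw [(hW g).mp hgW r, mul_zero]
        have h0 : ∑ j, ((if i = j then 1 else 0 : F) : L) * g j = g i := by
          simp [apply_ite (Subtype.val : F → L)]
        rw [← h0]
        simp_rw [← hz]
        simp only [Fintype.sum_sum_type, Sum.elim_inl, Sum.elim_inr]
        push_cast
        simp only [add_mul, Finset.sum_add_distrib, Finset.sum_mul]
        rw [Finset.sum_comm,
          Finset.sum_comm (s := (Finset.univ : Finset I)) (t := (Finset.univ : Finset ρ))]
        have h1 : ∑ r, ∑ j, (B r j : L) * z (Sum.inr r) * g j = 0 := by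
          refine Finset.sum_eq_zero fun r _ => ?_
          rw [← hB r, Finset.mul_sum]
          exact Finset.sum_congr rfl fun j _ => by ring
        rw [h1, add_zero]
        simp [apply_ite (Subtype.val : F → L)]
      rw [hgi, SetLike.mem_coe, IntermediateField.mem_restrictScalars]
      refine sum_mem fun c _ => mul_mem ?_ ?_
      · exact (IntermediateField.adjoin F (Set.range fun c => g (a c))).algebraMap_mem
          (z (Sum.inl c))
      · exact IntermediateField.subset_adjoin _ _ ⟨c, rfl⟩
    have h1 := trdeg_intermediateField_adjoin_le (k := F) (fun c => g (a c))
    rw [htop'] at h1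
    have h2 : Algebra.trdeg F L ≤ Module.finrank L W := by
      rw [← hcard]
      refine (trdeg_le_of_injective (IntermediateField.topEquiv (F := F) (E := L)).symm.toAlgHom
        (AlgEquiv.injective _)).trans (by simpa using h1)
    have h3 : Cardinal.mk I = Algebra.trdeg k L := hg.cardinalMk_eq_trdeg
    rw [Cardinal.mk_fintype] at h3
    rw [h3, ← _root_.trdeg_add_eq k F (A := L)]
    gcongr

/-! ### The dimension of an orbit -/

/-- A polynomial vanishes at the generic value of a family of rational functions with common
denominator `Δ` if and only if it vanishes at all values of that family at points where
`Δ ≠ 0`. -/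
theorem aeval_div_eq_zero_iff {k σ τ : Type} [Field k] [Infinite k] {Δ : MvPolynomial σ k}
    (hΔ : Δ ≠ 0) (num : τ → MvPolynomial σ k) (P : MvPolynomial τ k) :
    MvPolynomial.aeval (fun c => algebraMap _ (FractionRing (MvPolynomial σ k)) (num c) /
        algebraMap _ (FractionRing (MvPolynomial σ k)) Δ) P = 0 ↔
      ∀ γ, MvPolynomial.eval γ Δ ≠ 0 →
        MvPolynomial.eval (fun c => MvPolynomial.eval γ (num c) / MvPolynomial.eval γ Δ) P = 0 := by
  set K := FractionRing (MvPolynomial σ k)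
  have hΔK : algebraMap _ K Δ ≠ 0 := by simpa using hΔ
  have aux {E : Type} [Field E] (D x y : E) (N : ℕ) (hD : D ≠ 0) :
      D ^ N * x * y = D ^ (N + 1) * (x * (y / D)) := by rw [pow_succ]; field_simp
  -- Clearing denominators.
  have key : ∃ (N : ℕ) (r : MvPolynomial σ k), (algebraMap _ K r = algebraMap _ K Δ ^ N *
        MvPolynomial.aeval (fun c => algebraMap _ K (num c) / algebraMap _ K Δ) P) ∧
      ∀ γ, MvPolynomial.eval γ Δ ≠ 0 → MvPolynomial.eval γ r = MvPolynomial.eval γ Δ ^ N *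
        MvPolynomial.eval
          (fun c => MvPolynomial.eval γ (num c) / MvPolynomial.eval γ Δ) P := by
    induction P using MvPolynomial.induction_on with
    | C a =>
      refine ⟨0, MvPolynomial.C a, ?_, fun γ _ => by simp⟩
      rw [MvPolynomial.aeval_C, IsScalarTower.algebraMap_apply k (MvPolynomial σ k) K,
        MvPolynomial.algebraMap_eq, pow_zero, one_mul]
    | add P Q hP hQ =>
      obtain ⟨N, r, h1, h2⟩ := hP
      obtain ⟨M, s, h3, h4⟩ := hQ
      refine ⟨N + M, Δ ^ M * r + Δ ^ N * s, ?_, fun γ hγ => ?_⟩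
      · simp only [map_add, map_mul, map_pow, h1, h3]; ring
      · simp only [map_add, map_mul, map_pow, h2 γ hγ, h4 γ hγ]; ring
    | mul_X P c hP =>
      obtain ⟨N, r, h1, h2⟩ := hP
      refine ⟨N + 1, r * num c, ?_, fun γ hγ => ?_⟩
      · simpa only [map_mul, h1, MvPolynomial.aeval_X] using aux _ _ _ _ hΔK
      · simpa only [map_mul, h2 γ hγ, MvPolynomial.eval_X] using aux _ _ _ _ hγ
  obtain ⟨N, r, h1, h2⟩ := key
  constructor
  · intro h γ hγ
    rw [h, mul_zero] at h1
    have hr : r = 0 := by simpa using h1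
    have := h2 γ hγ
    rw [hr, map_zero] at this
    exact (mul_eq_zero.mp this.symm).resolve_left (pow_ne_zero _ hγ)
  · intro h
    have hr : r * Δ = 0 := by
      refine MvPolynomial.funext fun γ => ?_
      rw [map_mul, map_zero]
      by_cases hγ : MvPolynomial.eval γ Δ = 0
      · rw [hγ, mul_zero]
      · rw [h2 γ hγ, h γ hγ, mul_zero, zero_mul]
    have hr' : r = 0 := (mul_eq_zero.mp hr).resolve_right hΔ
    rw [hr', map_zero] at h1
    exact (mul_eq_zero.mp h1.symm).resolve_left (pow_ne_zero _ hΔK)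

section Orbit

variable {n : ℕ} (m : Multisegment n)

/-- Positions of the matrix entries of a graded endomorphism of the vector space underlying
`k[m]`. -/
abbrev EndIdx : Type := Σ j : ZMod n, Cell m j × Cell m j

variable {m}

/-- The component at the vertex `j` of the graded endomorphism with entries `y`. -/
def block {E : Type} (y : EndIdx m → E) (j : ZMod n) : Matrix (Cell m j) (Cell m j) E :=
  Matrix.of fun b a => y ⟨j, (b, a)⟩

/-- The matrix of `V_j → V_{j-1}` with entries `X`. -/
def arrow {E : Type} (X : Coord m → E) (j : ZMod n) : Matrix (Cell m (j - 1)) (Cell m j) E :=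
  Matrix.of fun b a => X ⟨j, (b, a)⟩

/-- The coordinates of a family of matrices of maps `V_j → V_{j-1}`. -/
def coords {E : Type} (M : ∀ j, Matrix (Cell m (j - 1)) (Cell m j) E) (c : Coord m) : E :=
  M c.1 c.2.1 c.2.2

/-- The graded endomorphisms `y` which intertwine the representation `k[m]` with the
representation on the same graded vector space given by the matrices `X`. -/
def intertwiners {E : Type} [Field E] (X : Coord m → E) : Submodule E (EndIdx m → E) where
  carrier := {y | ∀ j, block y (j - 1) * shift E m j = arrow X j * block y j}
  add_mem' {y z} hy hz j := by
    have h1 (j) : block (y + z) j = block y j + block z j := rfl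
    rw [h1, h1, Matrix.add_mul, Matrix.mul_add, hy j, hz j]
  zero_mem' j := by
    have h1 (j) : block (0 : EndIdx m → E) j = 0 := rfl
    rw [h1, h1, Matrix.zero_mul, Matrix.mul_zero]
  smul_mem' c y hy j := by
    have h1 (j) : block (c • y) j = c • block y j := rfl
    rw [h1, h1, Matrix.smul_mul, Matrix.mul_smul, hy j]

/-- The graded endomorphisms of the representation `k[m]`. -/
abbrev commutant (E : Type) [Field E] (m : Multisegment n) : Submodule E (EndIdx m → E) :=
  intertwiners (coords (shift E m))

theorem arrow_shift (E : Type) [Field E] (j : ZMod n) :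
    arrow (coords (shift E m)) j = shift E m j := rfl

/-- An invertible intertwiner identifies the space of intertwiners with the endomorphism
algebra. -/
theorem finrank_intertwiners {E : Type} [Field E] (X : Coord m → E) (g : EndIdx m → E)
    (hg : g ∈ intertwiners X) (hdet : ∀ j, (block g j).det ≠ 0) :
    Module.finrank E (intertwiners X) = Module.finrank E (commutant E m) := by
  have hu (j) : IsUnit (block g j).det := (hdet j).isUnit
  refine LinearEquiv.finrank_eq (LinearEquiv.symm
    { toFun := fun y => ⟨fun c => (block g c.1 * block y.1 c.1) c.2.1 c.2.2, fun j => ?_⟩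
      invFun := fun y => ⟨fun c => ((block g c.1)⁻¹ * block y.1 c.1) c.2.1 c.2.2, fun j => ?_⟩
      map_add' := fun y z => ?_
      map_smul' := fun c y => ?_
      left_inv := fun y => ?_
      right_inv := fun y => ?_ })
  · change block g (j - 1) * block y.1 (j - 1) * shift E m j =
      arrow X j * (block g j * block y.1 j)
    rw [Matrix.mul_assoc, y.2 j, arrow_shift, ← Matrix.mul_assoc, hg j, Matrix.mul_assoc]
  · refine Subtype.ext (funext fun c => ?_)
    exact congrFun (congrFun (Matrix.mul_add (block g c.1) (block y.1 c.1) (block z.1 c.1)) _) _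
  · refine Subtype.ext (funext fun e => ?_)
    exact congrFun (congrFun (Matrix.mul_smul (block g e.1) c (block y.1 e.1)) _) _
  · change (block g (j - 1))⁻¹ * block y.1 (j - 1) * shift E m j =
      shift E m j * ((block g j)⁻¹ * block y.1 j)
    have h : (block g (j - 1))⁻¹ * arrow X j = shift E m j * (block g j)⁻¹ := by
      have := hg j
      calc (block g (j - 1))⁻¹ * arrow X j
          = (block g (j - 1))⁻¹ * (arrow X j * block g j) * (block g j)⁻¹ := by
            rw [Matrix.mul_assoc, Matrix.mul_assoc, Matrix.mul_nonsing_inv _ (hu j),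
              Matrix.mul_one]
        _ = _ := by
            rw [← this, ← Matrix.mul_assoc, Matrix.nonsing_inv_mul _ (hu _), Matrix.one_mul]
    rw [Matrix.mul_assoc, y.2 j, ← Matrix.mul_assoc, h, Matrix.mul_assoc]
  · refine Subtype.ext (funext fun e => ?_)
    change ((block g e.1)⁻¹ * (block g e.1 * block y.1 e.1)) e.2.1 e.2.2 = _
    rw [← Matrix.mul_assoc, Matrix.nonsing_inv_mul _ (hu _), Matrix.one_mul]
    rfl
  · refine Subtype.ext (funext fun e => ?_)
    change (block g e.1 * ((block g e.1)⁻¹ * block y.1 e.1)) e.2.1 e.2.2 = _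
    rw [← Matrix.mul_assoc, Matrix.mul_nonsing_inv _ (hu _), Matrix.one_mul]
    rfl

/-- The matrices of `k[m]` have entries in the prime ring, so they do not change under ring
homomorphisms. -/
theorem shift_map {E E' : Type} [Field E] {R : Type} [CommRing R] [Field E'] (φ : R →+* E')
    (ψ : E →+* R) (j : ZMod n) :
    (((shift E m j).map ψ).map φ) = shift E' m j := by
  ext b a
  simp [shift, apply_ite φ, apply_ite ψ]

variable [NeZero n]

variable (m) in
/-- The product of the determinants of the components of the generic graded endomorphism. -/
def genericDet : MvPolynomial (EndIdx m) ℂ :=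
  ∏ j, (block (MvPolynomial.X : EndIdx m → MvPolynomial (EndIdx m) ℂ) j).det

/-- The numerators of the coordinates of `g x g⁻¹`, for the generic `g`, with respect to the common
denominator `genericDet m`. -/
def genericNum : Coord m → MvPolynomial (EndIdx m) ℂ :=
  coords fun j => (∏ j' ∈ Finset.univ.erase j,
      (block (MvPolynomial.X : EndIdx m → MvPolynomial (EndIdx m) ℂ) j').det) •
    (block (MvPolynomial.X : EndIdx m → MvPolynomial (EndIdx m) ℂ) (j - 1) *
      (((shift ℂ m j).map MvPolynomial.C :
        Matrix (Cell m (j - 1)) (Cell m j) (MvPolynomial (EndIdx m) ℂ)) *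
      (block (MvPolynomial.X : EndIdx m → MvPolynomial (EndIdx m) ℂ) j).adjugate :
        Matrix (Cell m (j - 1)) (Cell m j) (MvPolynomial (EndIdx m) ℂ)))

theorem map_genericDet {E : Type} [Field E] (φ : MvPolynomial (EndIdx m) ℂ →+* E) :
    φ (genericDet m) = ∏ j, (block (fun i => φ (MvPolynomial.X i)) j).det := by
  rw [genericDet, map_prod]
  refine Finset.prod_congr rfl fun j _ => ?_
  rw [RingHom.map_det]
  rfl

/-- The coordinates of the conjugate `g x g⁻¹` of the representation `k[m]`. -/
def conjPoint {E : Type} [Field E] (g : EndIdx m → E) : Coord m → E :=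
  coords fun j => block g (j - 1) * shift E m j * (block g j)⁻¹

theorem map_genericNum_div {E : Type} [Field E] (φ : MvPolynomial (EndIdx m) ℂ →+* E)
    (hφ : φ (genericDet m) ≠ 0) (c : Coord m) :
    φ (genericNum c) / φ (genericDet m) = conjPoint (fun i => φ (MvPolynomial.X i)) c := by
  obtain ⟨j, b, a⟩ := c
  set g : EndIdx m → E := fun i => φ (MvPolynomial.X i) with hg
  have h1 (j : ZMod n) : φ (block (MvPolynomial.X : EndIdx m → MvPolynomial (EndIdx m) ℂ) j).det
      = (block g j).det := by rw [RingHom.map_det]; rfl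
  rw [map_genericDet, ← hg] at hφ ⊢
  have h2 : (block g j).det ≠ 0 := fun h =>
    hφ (Finset.prod_eq_zero (Finset.mem_univ j) h)
  have h3 : ∏ j ∈ Finset.univ.erase j, (block g j).det ≠ 0 := fun h => by
    rw [← Finset.mul_prod_erase _ _ (Finset.mem_univ j), h, mul_zero] at hφ
    exact hφ rfl
  have h4 : φ ((block (MvPolynomial.X : EndIdx m → MvPolynomial (EndIdx m) ℂ) (j - 1) *
      (((shift ℂ m j).map MvPolynomial.C :
        Matrix (Cell m (j - 1)) (Cell m j) (MvPolynomial (EndIdx m) ℂ)) *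
      (block (MvPolynomial.X : EndIdx m → MvPolynomial (EndIdx m) ℂ) j).adjugate :
        Matrix (Cell m (j - 1)) (Cell m j) (MvPolynomial (EndIdx m) ℂ))) b a)
      = (block g (j - 1) * (shift E m j * (block g j).adjugate)) b a := by
    rw [← Matrix.map_apply (f := φ), Matrix.map_mul, Matrix.map_mul, shift_map φ MvPolynomial.C,
      ← RingHom.mapMatrix_apply φ (Matrix.adjugate _), RingHom.map_adjugate]
    rfl
  simp only [genericNum, conjPoint, coords, Matrix.smul_apply, smul_eq_mul, map_mul, map_prod, h4,
    h1]
  rw [← Finset.mul_prod_erase _ _ (Finset.mem_univ j), Matrix.inv_def, Ring.inverse_eq_inv',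
    Matrix.mul_smul, Matrix.smul_apply, smul_eq_mul, Matrix.mul_assoc]
  field_simp

theorem genericDet_ne_zero : genericDet m ≠ 0 := by
  intro h
  have h1 := map_genericDet
    (MvPolynomial.eval (fun i : EndIdx m => if i.2.1 = i.2.2 then (1 : ℂ) else 0))
  have h2 (j : ZMod n) : block (fun i : EndIdx m => MvPolynomial.eval
      (fun i : EndIdx m => if i.2.1 = i.2.2 then (1 : ℂ) else 0) (MvPolynomial.X i)) j = 1 := by
    ext b a
    simp [block, Matrix.one_apply]
  simp only [h, h2, map_zero, Matrix.det_one, Finset.prod_const_one] at h1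
  exact zero_ne_one h1

variable (m) in
/-- The field of rational functions in the entries of a graded endomorphism. -/
abbrev GenericField : Type := FractionRing (MvPolynomial (EndIdx m) ℂ)

/-- The coordinates of the generic point `g x g⁻¹` of the orbit. -/
def genericPoint (c : Coord m) : GenericField m :=
  algebraMap _ (GenericField m) (genericNum c) / algebraMap _ (GenericField m) (genericDet m)

theorem genericPoint_eq :
    genericPoint = conjPoint (fun i : EndIdx m =>
      algebraMap (MvPolynomial (EndIdx m) ℂ) (GenericField m) (MvPolynomial.X i)) :=
  funext fun c => map_genericNum_div (algebraMap _ (GenericField m))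
    (by simpa using genericDet_ne_zero) c

omit [NeZero n] in
theorem orbit_eq : orbit m =
    {x | ∃ γ : EndIdx m → ℂ, (∀ j, (block γ j).det ≠ 0) ∧ x = conjPoint γ} := by
  ext x
  constructor
  · rintro ⟨g, rfl⟩
    refine ⟨fun i => (g i.1).val i.2.1 i.2.2, fun j =>
      ((Matrix.isUnit_iff_isUnit_det _).mp (g j).isUnit).ne_zero, funext fun c => ?_⟩
    simp only [Matrix.coe_units_inv]
    rfl
  · rintro ⟨γ, hγ, rfl⟩
    refine ⟨fun j => Matrix.GeneralLinearGroup.mkOfDetNeZero (block γ j) (hγ j),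
      funext fun c => ?_⟩
    simp only [Matrix.coe_units_inv]
    rfl

/-- The polynomials vanishing on the orbit are those vanishing at its generic point. -/
theorem vanishingIdeal_orbit :
    MvPolynomial.vanishingIdeal ℂ (orbit m) =
      RingHom.ker (MvPolynomial.aeval (R := ℂ) (genericPoint (m := m))) := by
  ext P
  rw [RingHom.mem_ker, MvPolynomial.mem_vanishingIdeal_iff]
  refine Iff.trans ?_ (aeval_div_eq_zero_iff genericDet_ne_zero genericNum P).symm
  have hdet (γ : EndIdx m → ℂ) : MvPolynomial.eval γ (genericDet m) ≠ 0 ↔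
      ∀ j, (block γ j).det ≠ 0 := by
    rw [map_genericDet]
    simp [Finset.prod_eq_zero_iff]
  have hev (γ : EndIdx m → ℂ) (hγ : MvPolynomial.eval γ (genericDet m) ≠ 0) :
      (fun c => MvPolynomial.eval γ (genericNum c) / MvPolynomial.eval γ (genericDet m)) =
        conjPoint γ := by
    funext c
    rw [map_genericNum_div _ hγ]
    simp only [MvPolynomial.eval_X]
  rw [orbit_eq]
  constructor
  · intro h γ hγ
    rw [hev γ hγ, ← MvPolynomial.coe_aeval_eq_eval]
    exact h _ ⟨γ, (hdet γ).mp hγ, rfl⟩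
  · rintro h _ ⟨γ, hγ, rfl⟩
    have := h γ ((hdet γ).mpr hγ)
    rwa [hev γ ((hdet γ).mpr hγ), ← MvPolynomial.coe_aeval_eq_eval] at this

/-- The dimension of the orbit is the transcendence degree of the field generated by the
coordinates of its generic point. -/
theorem trdeg_coordinateRing_orbit :
    Algebra.trdeg ℂ (MvPolynomial (Coord m) ℂ ⧸ MvPolynomial.vanishingIdeal ℂ (orbit m)) =
      Algebra.trdeg ℂ (IntermediateField.adjoin ℂ (Set.range (genericPoint (m := m)))) := by
  rw [trdeg_intermediateField_adjoin, Algebra.adjoin_range_eq_range_aeval]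
  have h1 := (Ideal.quotientEquivAlgOfEq ℂ (vanishingIdeal_orbit (m := m))).trdeg_eq
  have h2 := (Ideal.quotientKerEquivRange
    (MvPolynomial.aeval (R := ℂ) (genericPoint (m := m)))).trdeg_eq
  exact h1.trans h2

/-- The dimension of the orbit of `k[m]` is the dimension of the group minus the dimension of the
endomorphism algebra. -/
theorem orbitDim_add_finrank_commutant :
    orbitDim m + Module.finrank (GenericField m) (commutant (GenericField m) m) =
      ∑ j, dimVec m j ^ 2 := by
  classical
  set g : EndIdx m → GenericField m := fun i =>
    algebraMap (MvPolynomial (EndIdx m) ℂ) (GenericField m) (MvPolynomial.X i) with hgdef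
  have hdet' : ∏ j, (block g j).det ≠ 0 := by
    rw [hgdef, ← map_genericDet (algebraMap _ (GenericField m))]
    simpa using genericDet_ne_zero
  have hdet (j) : (block g j).det ≠ 0 := fun h =>
    hdet' (Finset.prod_eq_zero (Finset.mem_univ j) h)
  have hgW : g ∈ intertwiners (genericPoint (m := m)) := by
    intro j
    have : arrow genericPoint j = block g (j - 1) * shift (GenericField m) m j *
        (block g j)⁻¹ := by
      rw [genericPoint_eq]
      rfl
    rw [this, Matrix.mul_assoc, Matrix.nonsing_inv_mul _ (hdet j).isUnit, Matrix.mul_one]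
  rw [← finrank_intertwiners genericPoint g hgW hdet]
  -- The field of definition of the space of intertwiners.
  set F := IntermediateField.adjoin ℂ (Set.range (genericPoint (m := m))) with hFdef
  let Xf (c : Coord m) : F := ⟨genericPoint c, IntermediateField.subset_adjoin _ _ ⟨c, rfl⟩⟩
  have : Algebra.IsAlgebraic (MvPolynomial (EndIdx m) ℂ) (GenericField m) :=
    IsLocalization.isAlgebraic _ (nonZeroDivisors (MvPolynomial (EndIdx m) ℂ))
  have hg : IsTranscendenceBasis ℂ g :=
    (IsTranscendenceBasis.mvPolynomial (EndIdx m) ℂ).algebraMap_comp (A := GenericField m)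
  have haev (p : MvPolynomial (EndIdx m) ℂ) :
      MvPolynomial.aeval g p = algebraMap _ (GenericField m) p := by
    have : MvPolynomial.aeval g = IsScalarTower.toAlgHom ℂ (MvPolynomial (EndIdx m) ℂ)
      (GenericField m) := by ext i; simp [g]
    rw [this]; rfl
  have htop : IntermediateField.adjoin ℂ (Set.range g) = ⊤ := by
    rw [eq_top_iff]
    intro x _
    obtain ⟨p, q, _, rfl⟩ := IsFractionRing.div_surjective (A := MvPolynomial (EndIdx m) ℂ) x
    have h (p : MvPolynomial (EndIdx m) ℂ) : algebraMap _ (GenericField m) p ∈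
        IntermediateField.adjoin ℂ (Set.range g) := by
      rw [← haev]
      refine IntermediateField.algebra_adjoin_le_adjoin ℂ _ ?_
      rw [Algebra.adjoin_range_eq_range_aeval]
      exact ⟨p, rfl⟩
    exact div_mem (h p) (h q)
  have hmain := trdeg_add_finrank_eq_card (k := ℂ) F
    (fun (r : Coord m) (i : EndIdx m) =>
      (∑ c, if (⟨r.1 - 1, (r.2.1, c)⟩ : EndIdx m) = i then shift F m r.1 c r.2.2 else 0) -
        ∑ c, if (⟨r.1, (c, r.2.2)⟩ : EndIdx m) = i then Xf ⟨r.1, (r.2.1, c)⟩ else 0)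
    (intertwiners (genericPoint (m := m))) ?_ g hg htop hgW (genericDet m) ?_ ?_
  · rw [orbitDim, trdeg_coordinateRing_orbit]
    have hlt : Algebra.trdeg ℂ F < Cardinal.aleph0 :=
      lt_of_le_of_lt (self_le_add_right _ _) (hmain.trans_lt (Cardinal.natCast_lt_aleph0))
    have := congrArg Cardinal.toNat hmain
    rw [Cardinal.toNat_add hlt Cardinal.natCast_lt_aleph0, Cardinal.toNat_natCast,
      Cardinal.toNat_natCast] at this
    rw [this, Fintype.card_sigma]
    refine Finset.sum_congr rfl fun j _ => ?_
    rw [Fintype.card_prod, dimVec, sq]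
  · intro y
    have h (r : Coord m) : ∑ i, (((∑ c, if (⟨r.1 - 1, (r.2.1, c)⟩ : EndIdx m) = i then
        shift F m r.1 c r.2.2 else 0) -
        ∑ c, if (⟨r.1, (c, r.2.2)⟩ : EndIdx m) = i then Xf ⟨r.1, (r.2.1, c)⟩ else 0 : F) :
          GenericField m) * y i =
        (block y (r.1 - 1) * shift (GenericField m) m r.1) r.2.1 r.2.2 -
          (arrow (genericPoint (m := m)) r.1 * block y r.1) r.2.1 r.2.2 := by
      push_cast
      simp only [sub_mul, Finset.sum_sub_distrib, Finset.sum_mul]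
      rw [Finset.sum_comm, Finset.sum_comm (s := (Finset.univ : Finset (EndIdx m)))]
      simp [apply_ite (Subtype.val : F → GenericField m), ite_mul, Matrix.mul_apply, block, arrow,
        Xf, shift]
    simp_rw [h, sub_eq_zero]
    exact ⟨fun hy r => congrFun (congrFun (hy r.1) _) _,
      fun hy j => Matrix.ext fun b a => hy ⟨j, (b, a)⟩⟩
  · rw [haev]
    simpa using genericDet_ne_zero
  · -- An invertible intertwiner `w` recovers the generic point as `w x w⁻¹`.
    intro w hw hwdet
    rw [IntermediateField.adjoin_le_iff]
    set E := IntermediateField.adjoin ℂ (Set.range w)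
    let wE (i : EndIdx m) : E := ⟨w i, IntermediateField.subset_adjoin _ _ ⟨i, rfl⟩⟩
    have hd := map_genericDet (MvPolynomial.aeval (R := ℂ) w).toRingHom
    simp only [AlgHom.toRingHom_eq_coe, RingHom.coe_coe, MvPolynomial.aeval_X] at hd
    rw [hd] at hwdet
    have hdw (j) : (block w j).det ≠ 0 := fun h =>
      hwdet (Finset.prod_eq_zero (Finset.mem_univ j) h)
    have hdE (j) : (block wE j).det ≠ 0 := by
      intro h
      apply hdw j
      have := RingHom.map_det (algebraMap E (GenericField m)) (block wE j)
      rw [h, map_zero] at this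
      exact this.symm
    rintro _ ⟨⟨j, b, a⟩, rfl⟩
    set A : Matrix (Cell m (j - 1)) (Cell m j) (GenericField m) := arrow genericPoint j with hA
    have hwj : block w (j - 1) * shift (GenericField m) m j = A * block w j := hw j
    have hwE (j) : block w j = (block wE j).map (algebraMap E (GenericField m)) := rfl
    have hsh : shift (GenericField m) m j =
        (shift E m j).map (algebraMap E (GenericField m)) :=
      (shift_map (algebraMap E (GenericField m)) (RingHom.id E) j).symm
    have : A = (block wE (j - 1) * (shift E m j * (block wE j)⁻¹)).map
        (algebraMap E (GenericField m)) := by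
      rw [← Matrix.mul_one A, ← Matrix.mul_nonsing_inv _ (hdw j).isUnit, ← Matrix.mul_assoc,
        ← hwj]
      have hinv : (block w j)⁻¹ = (block wE j)⁻¹.map (algebraMap E (GenericField m)) := by
        refine Matrix.inv_eq_right_inv ?_
        rw [hwE, ← Matrix.map_mul, Matrix.mul_nonsing_inv _ (hdE j).isUnit,
          Matrix.map_one _ (map_zero _) (map_one _)]
      rw [hinv, hwE, hsh, ← Matrix.map_mul, ← Matrix.map_mul, Matrix.mul_assoc]
    have h := congrFun (congrFun this b) a
    change genericPoint ⟨j, (b, a)⟩ = _ at h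
    rw [h]
    exact Subtype.prop _

end Orbit

/-! ### The endomorphism algebra of `k[m]` -/

section Cells

variable {n : ℕ} {m : Multisegment n}

/-- The length of an individual segment. -/
abbrev Copy.len (p : Copy m) : ℕ := (p.1.1.1 : ℕ)

/-- The vertex supporting the head of an individual segment. -/
abbrev Copy.head (p : Copy m) : ZMod n := p.1.1.2

/-- The position of a basis vector in its segment. -/
abbrev Cell.pos {j : ZMod n} (a : Cell m j) : ℕ := (a.2.1 : ℕ)

theorem Cell.pos_lt {j : ZMod n} (a : Cell m j) : a.pos < a.1.len := a.2.1.2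

theorem Cell.head_sub_pos {j : ZMod n} (a : Cell m j) : a.1.head - (a.pos : ZMod n) = j := a.2.2

theorem Cell.ext {j : ZMod n} {a b : Cell m j} (h : a.1 = b.1) (h' : a.pos = b.pos) : a = b := by
  obtain ⟨p, ⟨c, hc⟩, hj⟩ := a
  obtain ⟨p', ⟨c', hc'⟩, hj'⟩ := b
  obtain rfl : p = p' := h
  obtain rfl : c = c' := h'
  rfl

/-- The basis vector in position `c` of the segment `p`. -/
def Copy.cell (p : Copy m) (c : ℕ) (hc : c < p.len) {j : ZMod n} (hj : p.head - (c : ZMod n) = j) :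
    Cell m j :=
  ⟨p, ⟨c, hc⟩, hj⟩

/-- The image of a basis vector, if it is not zero. -/
def Cell.next {j : ZMod n} (a : Cell m j) (h : a.pos + 1 < a.1.len) : Cell m (j - 1) :=
  a.1.cell (a.pos + 1) h (by
    rw [Nat.cast_add, Nat.cast_one, ← sub_sub, a.head_sub_pos])

/-- The preimage of a basis vector which is not the head of its segment. -/
def Cell.prev {j : ZMod n} (b : Cell m (j - 1)) (h : 0 < b.pos) : Cell m j :=
  b.1.cell (b.pos - 1) (lt_of_le_of_lt (Nat.sub_le _ _) b.pos_lt) (by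
    have := b.head_sub_pos
    rw [Nat.cast_sub h, Nat.cast_one, sub_sub_eq_add_sub, add_sub_right_comm, this, sub_add_cancel])

theorem sum_mul_shift {E : Type} [Field E] {j : ZMod n} (f : Cell m (j - 1) → E) (a : Cell m j) :
    ∑ c, f c * shift E m j c a = if h : a.pos + 1 < a.1.len then f (a.next h) else 0 := by
  classical
  split_ifs with h
  · rw [Finset.sum_eq_single (a.next h)]
    · simp [shift, Cell.next, Copy.cell]
    · intro c _ hc
      rw [shift, Matrix.of_apply, if_neg, mul_zero]
      exact fun h' => hc (Cell.ext h'.1 h'.2)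
    · simp
  · refine Finset.sum_eq_zero fun c _ => ?_
    rw [shift, Matrix.of_apply, if_neg, mul_zero]
    intro h'
    apply h
    rw [← h'.1, ← h'.2]
    exact c.pos_lt

theorem sum_shift_mul {E : Type} [Field E] {j : ZMod n} (f : Cell m j → E) (b : Cell m (j - 1)) :
    ∑ c, shift E m j b c * f c = if h : 0 < b.pos then f (b.prev h) else 0 := by
  classical
  split_ifs with h
  · rw [Finset.sum_eq_single (b.prev h)]
    · rw [shift, Matrix.of_apply, if_pos, one_mul]
      exact ⟨rfl, (Nat.sub_add_cancel h).symm⟩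
    · intro c _ hc
      rw [shift, Matrix.of_apply, if_neg, zero_mul]
      intro h'
      refine hc (Cell.ext h'.1.symm ?_)
      change c.pos = b.pos - 1
      exact (Nat.sub_eq_of_eq_add h'.2).symm
    · simp
  · refine Finset.sum_eq_zero fun c _ => ?_
    rw [shift, Matrix.of_apply, if_neg, zero_mul]
    exact fun h' => h (by rw [show b.pos = _ from h'.2]; exact Nat.succ_pos _)

theorem mem_commutant_iff {E : Type} [Field E] (y : EndIdx m → E) :
    y ∈ commutant E m ↔ ∀ (j : ZMod n) (b : Cell m (j - 1)) (a : Cell m j),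
      (if h : a.pos + 1 < a.1.len then y ⟨j - 1, (b, a.next h)⟩ else 0) =
        if h : 0 < b.pos then y ⟨j, (b.prev h, a)⟩ else 0 := by
  have h (j : ZMod n) (b : Cell m (j - 1)) (a : Cell m j) :
      ((block y (j - 1) * shift E m j) b a = (shift E m j * block y j) b a) ↔
      ((if h : a.pos + 1 < a.1.len then y ⟨j - 1, (b, a.next h)⟩ else 0) =
        if h : 0 < b.pos then y ⟨j, (b.prev h, a)⟩ else 0) := by
    rw [Matrix.mul_apply, Matrix.mul_apply,
      sum_mul_shift (fun c => block y (j - 1) b c) a, sum_shift_mul (fun c => block y j c a) b]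
    rfl
  constructor
  · exact fun hy j b a => (h j b a).mp (congrFun (congrFun (hy j) b) a)
  · exact fun hy j => Matrix.ext fun b a => (h j b a).mpr (hy j b a)

variable (m) in
/-- An index set for a basis of the endomorphism algebra of `k[m]`: the triples `(p, p', d)` such
that there is a homomorphism which takes the head of the segment `p'` to the basis vector in
position `d` of the segment `p`. -/
abbrev HomIdx : Type :=
  Σ t : Copy m × Copy m, {d : Fin t.1.len //
    t.1.head - ((d : ℕ) : ZMod n) = t.2.head ∧ t.1.len ≤ t.2.len + d}

/-- An endomorphism of `k[m]` vanishes if the images of the heads vanish; the coordinates indexed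
by `HomIdx m` suffice, because the image of a head is killed by the same power of the arrows as the
head. -/
theorem commutant_eq_zero {E : Type} [Field E] {y : EndIdx m → E} (hy : y ∈ commutant E m)
    (h0 : ∀ t : HomIdx m, y ⟨t.1.2.head, (t.1.1.cell t.2.1 t.2.1.2 t.2.2.1,
      t.1.2.cell 0 t.1.2.1.1.1.pos (by simp))⟩ = 0) : y = 0 := by
  rw [mem_commutant_iff] at hy
  -- The image of a basis vector `a` is killed by any power of the arrows that kills `a`.
  have hker (r : ℕ) : ∀ (j : ZMod n) (b a : Cell m j), a.1.len - a.pos = r →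
      a.1.len - a.pos < b.1.len - b.pos → y ⟨j, (b, a)⟩ = 0 := by
    induction r with
    | zero => intro j b a hr _; have := a.pos_lt; omega
    | succ r ih =>
      intro j b a hr hlt
      have hb : b.pos + 1 < b.1.len := by have := a.pos_lt; omega
      have h := hy j (b.next hb) a
      rw [dif_pos (show 0 < (b.next hb).pos from Nat.succ_pos _)] at h
      have hprev : (b.next hb).prev (Nat.succ_pos _) = b := Cell.ext rfl rfl
      rw [hprev] at h
      rw [← h]
      split_ifs with ha
      · refine ih (j - 1) (b.next hb) (a.next ha) ?_ ?_
        · change a.1.len - (a.pos + 1) = r; omega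
        · change a.1.len - (a.pos + 1) < b.1.len - (b.pos + 1); omega
      · rfl
  have hall (c : ℕ) : ∀ (j : ZMod n) (b a : Cell m j), a.pos = c → y ⟨j, (b, a)⟩ = 0 := by
    induction c with
    | zero =>
      intro j b a ha
      by_cases hlen : b.1.len ≤ a.1.len + b.pos
      · have hhead (p : Copy m) (j : ZMod n) (hj : p.head = j) (b : Cell m j)
            (hb : b.1.len ≤ p.len + b.pos) :
            y ⟨j, (b, p.cell 0 p.1.1.1.pos (by simpa using hj))⟩ = 0 := by
          subst hj
          exact h0 ⟨(b.1, p), ⟨b.2.1, b.head_sub_pos, hb⟩⟩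
        have hj : a.1.head = j := by simpa [ha] using a.head_sub_pos
        rw [← hhead a.1 j hj b hlen]
        congr 3
        exact Cell.ext rfl ha
      · refine hker _ j b a rfl ?_
        have := b.pos_lt
        omega
    | succ c ih =>
      intro j b a ha
      obtain ⟨j, rfl⟩ : ∃ j', j = j' - 1 := ⟨j + 1, by ring⟩
      have ha0 : 0 < a.pos := by omega
      have h := hy j b (a.prev ha0)
      have hlt : (a.prev ha0).pos + 1 < (a.prev ha0).1.len := by
        change a.pos - 1 + 1 < a.1.len
        have := a.pos_lt
        omega
      rw [dif_pos hlt] at h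
      have hnext : (a.prev ha0).next hlt = a :=
        Cell.ext rfl (show a.pos - 1 + 1 = a.pos by omega)
      rw [hnext] at h
      rw [h]
      split_ifs with hb
      · exact ih _ _ _ (show a.pos - 1 = c by omega)
      · rfl
  funext ⟨j, b, a⟩
  exact hall _ j b a rfl

/-- The coordinates indexed by `HomIdx m` of the images of the heads can be prescribed
arbitrarily, and they determine the endomorphism. -/
theorem finrank_commutant (E : Type) [Field E] :
    Module.finrank E (commutant E m) = Fintype.card (HomIdx m) := by
  classical
  let ev : commutant E m →ₗ[E] HomIdx m → E :=
    { toFun := fun y t => y.1 ⟨t.1.2.head, (t.1.1.cell t.2.1 t.2.1.2 t.2.2.1,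
        t.1.2.cell 0 t.1.2.1.1.1.pos (by simp))⟩
      map_add' := fun _ _ => rfl
      map_smul' := fun _ _ => rfl }
  have hinj : Function.Injective ev := (injective_iff_map_eq_zero ev).mpr fun y hy =>
    Subtype.ext (commutant_eq_zero y.2 fun t => congrFun hy t)
  have hsurj : Function.Surjective ev := by
    intro z
    -- The head of `p'` goes to `∑ z' p p' d • (p, d)`, hence position `c` of `p'` to
    -- `∑ z' p p' d • (p, c + d)`.
    let z' (p p' : Copy m) (d : ℕ) : E :=
      if h : d < p.len ∧ p.head - (d : ZMod n) = p'.head ∧ p.len ≤ p'.len + d then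
        z ⟨(p, p'), ⟨⟨d, h.1⟩, h.2⟩⟩ else 0
    let y (i : EndIdx m) : E :=
      if i.2.2.pos ≤ i.2.1.pos then z' i.2.1.1 i.2.2.1 (i.2.1.pos - i.2.2.pos) else 0
    have hy : y ∈ commutant E m := by
      rw [mem_commutant_iff]
      intro j b a
      split_ifs with ha hb hb
      · change (if a.pos + 1 ≤ b.pos then z' b.1 a.1 (b.pos - (a.pos + 1)) else 0) =
          if a.pos ≤ b.pos - 1 then z' b.1 a.1 (b.pos - 1 - a.pos) else 0
        rw [show b.pos - (a.pos + 1) = b.pos - 1 - a.pos by omega]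
        exact if_congr (by omega) rfl rfl
      · change (if a.pos + 1 ≤ b.pos then z' b.1 a.1 (b.pos - (a.pos + 1)) else 0) = 0
        rw [if_neg (by omega)]
      · change 0 = if a.pos ≤ b.pos - 1 then z' b.1 a.1 (b.pos - 1 - a.pos) else 0
        split_ifs with h
        · have h1 := b.pos_lt
          have h2 := a.pos_lt
          simp only [z']
          rw [dif_neg]
          rintro ⟨_, _, h3⟩
          omega
        · rfl
      · rfl
    refine ⟨⟨y, hy⟩, funext fun ⟨⟨p, p'⟩, ⟨d, hd⟩⟩ => ?_⟩
    change (if 0 ≤ (d : ℕ) then z' p p' ((d : ℕ) - 0) else 0) = _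
    rw [if_pos (Nat.zero_le _), Nat.sub_zero]
    exact dif_pos ⟨d.2, hd⟩
  rw [(LinearEquiv.ofBijective ev ⟨hinj, hsurj⟩).finrank_eq, Module.finrank_fintype_fun_eq_card]

end Cells

/-! ### Counting basis vectors and homomorphisms -/

section Counting

variable {n : ℕ}

/-- The dimension at the vertex `j` of the indecomposable module of length `l` and head at the
vertex `i`; here `l = 0` is allowed. -/
def cellCount (l : ℕ) (i j : ZMod n) : ℕ := {c ∈ Finset.range l | i - ((c : ℕ) : ZMod n) = j}.card

/-- The dimension of the space of homomorphisms from the indecomposable module of length `l` and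
head at the vertex `i` to the one of length `l'` and head at the vertex `i'`. -/
def homCount (l : ℕ) (i : ZMod n) (l' : ℕ) (i' : ZMod n) : ℕ :=
  {c ∈ Finset.range l' | i' - ((c : ℕ) : ZMod n) = i ∧ l' ≤ l + c}.card

/-- The sum of `f` over the individual segments occurring in a multisegment. -/
abbrev segSum (f : Segment n → ℤ) : Multisegment n →ₗ[ℕ] ℤ := Finsupp.linearCombination ℕ f

theorem segSum_add_apply (m : Multisegment n) (f g : Segment n → ℤ) :
    segSum (fun s => f s + g s) m = segSum f m + segSum g m := by
  simp only [segSum, Finsupp.linearCombination_apply, Finsupp.sum, ← Finset.sum_add_distrib,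
    ← smul_add]

theorem sum_copy (m : Multisegment n) (f : Segment n → ℤ) :
    ∑ p : Copy m, f p.1 = segSum f m := by
  rw [Fintype.sum_sigma, segSum, Finsupp.linearCombination_apply, Finsupp.sum]
  simp only [Finset.sum_const, Finset.card_univ, Fintype.card_fin]
  exact Finset.sum_coe_sort m.support (fun s => m s • f s)

theorem card_fin_subtype (l : ℕ) (P : ℕ → Prop) [DecidablePred P] :
    Fintype.card {c : Fin l // P c} = {c ∈ Finset.range l | P c}.card := by
  rw [Fintype.card_subtype, Finset.card_filter, Finset.card_filter,
    Fin.sum_univ_eq_sum_range (fun c => if P c then 1 else 0)]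

theorem dimVec_eq (m : Multisegment n) (j : ZMod n) :
    (dimVec m j : ℤ) = segSum (fun s => (cellCount (s.1 : ℕ) s.2 j : ℤ)) m := by
  rw [← sum_copy, dimVec, Fintype.card_sigma]
  push_cast
  exact Finset.sum_congr rfl fun p _ => by
    rw [card_fin_subtype p.len (fun c => p.head - (c : ZMod n) = j)]; rfl

theorem card_homIdx (m : Multisegment n) :
    (Fintype.card (HomIdx m) : ℤ) = segSum (fun s' => segSum (fun s =>
      (homCount (s.1 : ℕ) s.2 (s'.1 : ℕ) s'.2 : ℤ)) m) m := by
  rw [← sum_copy, Fintype.card_sigma, Fintype.sum_prod_type]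
  push_cast
  refine Finset.sum_congr rfl fun p _ => ?_
  rw [← sum_copy]
  refine Finset.sum_congr rfl fun p' _ => ?_
  rw [card_fin_subtype p.len (fun d => p.head - (d : ZMod n) = p'.head ∧ p.len ≤ p'.len + d)]
  rfl

theorem homCount_zero_right (l : ℕ) (i i' : ZMod n) : homCount l i 0 i' = 0 := rfl

theorem homCount_zero_left (i : ZMod n) (l' : ℕ) (i' : ZMod n) : homCount 0 i l' i' = 0 := by
  refine Finset.card_eq_zero.mpr (Finset.filter_eq_empty_iff.mpr fun c hc => ?_)
  rw [Finset.mem_range] at hc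
  omega

/-- Comparison of a segment with the segment obtained by deleting its head. -/
theorem cellCount_succ (l : ℕ) (i j : ZMod n) :
    cellCount (l + 1) i j = cellCount l (i - 1) j + if i = j then 1 else 0 := by
  rw [cellCount, cellCount, Finset.card_filter, Finset.card_filter, Finset.sum_range_succ']
  congr 1
  · refine Finset.sum_congr rfl fun c _ => if_congr ?_ rfl rfl
    rw [Nat.cast_add, Nat.cast_one, add_comm, sub_sub]
  · simp

/-- Translation of the vertex, in which only the two ends of the segment matter. -/
theorem cellCount_add (l : ℕ) (i j : ZMod n) :
    cellCount l i j + (if i = j - 1 then 1 else 0) =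
      cellCount l i (j - 1) + if i - (l : ZMod n) = j - 1 then 1 else 0 := by
  have h1 := Finset.sum_range_succ (fun c : ℕ => if i - (c : ZMod n) = j - 1 then 1 else 0) l
  have h2 := Finset.sum_range_succ' (fun c : ℕ => if i - (c : ZMod n) = j - 1 then 1 else 0) l
  have h3 (c : ℕ) : i - ((c + 1 : ℕ) : ZMod n) = j - 1 ↔ i - (c : ZMod n) = j := by
    rw [Nat.cast_add, Nat.cast_one, ← sub_sub, sub_left_inj]
  simp only [h3, Nat.cast_zero, sub_zero] at h2
  rw [cellCount, cellCount, Finset.card_filter, Finset.card_filter, ← h2, ← h1]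

/-- The effect on homomorphisms to a fixed segment of deleting the head of the source. -/
theorem homCount_succ_left (l : ℕ) (i : ZMod n) (k : ℕ) (hk : 0 < k) (j : ZMod n) :
    homCount (l + 1) i k j + (if j = i - 1 ∧ k ≤ l then 1 else 0) =
      homCount l (i - 1) k j + if j - (k : ZMod n) = i - 1 then 1 else 0 := by
  obtain ⟨k, rfl⟩ := Nat.exists_eq_succ_of_ne_zero hk.ne'
  have h1 := Finset.sum_range_succ
    (fun c : ℕ => if j - (c : ZMod n) = i ∧ k + 1 ≤ l + 1 + c then 1 else 0) k
  have h2 := Finset.sum_range_succ'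
    (fun c : ℕ => if j - (c : ZMod n) = i - 1 ∧ k + 1 ≤ l + c then 1 else 0) k
  have h3 (c : ℕ) : j - ((c + 1 : ℕ) : ZMod n) = i - 1 ↔ j - (c : ZMod n) = i := by
    rw [Nat.cast_add, Nat.cast_one, ← sub_sub, sub_left_inj]
  have h4 (c : ℕ) : k + 1 ≤ l + (c + 1) ↔ k + 1 ≤ l + 1 + c := by omega
  simp only [h3, h4, Nat.cast_zero, sub_zero, add_zero] at h2
  rw [homCount, homCount, Finset.card_filter, Finset.card_filter, Nat.succ_eq_add_one, h1, h2]
  simp only [h3, show k + 1 ≤ l + 1 + k by omega, and_true]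
  ring

/-- The effect on homomorphisms from a fixed segment of deleting the head of the target. -/
theorem homCount_succ_right (l : ℕ) (i : ZMod n) (k : ℕ) (j : ZMod n) :
    homCount k j (l + 1) i =
      homCount k j l (i - 1) + if j = i ∧ l + 1 ≤ k then 1 else 0 := by
  rw [homCount, homCount, Finset.card_filter, Finset.card_filter, Finset.sum_range_succ']
  congr 1
  · refine Finset.sum_congr rfl fun c _ => if_congr ?_ rfl rfl
    rw [Nat.cast_add, Nat.cast_one, add_comm (c : ZMod n), sub_sub]
    exact and_congr_right fun _ => by omega
  · simp [eq_comm]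

/-- `q` arises from `m` by replacing a segment `(l-1;i-1]` with `(l;i]`; for `l = 1`, by adding the
segment `(1;i]`. -/
def Extends (m : Multisegment n) (l : ℕ+) (i : ZMod n) (q : Multisegment n) : Prop :=
  (l = 1 ∧ q = m + Finsupp.single (1, i) 1) ∨
    (1 < l ∧ q + Finsupp.single (l - 1, i - 1) 1 = m + Finsupp.single (l, i) 1)

/-- The change of an additive function of the segments; the convention `f 0 (i - 1) = 0` covers the
case where a segment of length `1` is added. -/
theorem Extends.segSum_add {m q : Multisegment n} {l : ℕ+} {i : ZMod n} (h : Extends m l i q)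
    (f : ℕ → ZMod n → ℤ) (hf : f 0 (i - 1) = 0) :
    segSum (fun s => f (s.1 : ℕ) s.2) q =
      segSum (fun s => f (s.1 : ℕ) s.2) m + f (l : ℕ) i - f ((l : ℕ) - 1) (i - 1) := by
  obtain ⟨rfl, rfl⟩ | ⟨hl, h⟩ := h
  · simp [hf]
  · have := congrArg (segSum (fun s => f (s.1 : ℕ) s.2)) h
    simp only [map_add, Finsupp.linearCombination_single, one_smul] at this
    rw [PNat.sub_coe, if_pos hl, PNat.one_coe] at this
    linarith

theorem Extends.dimVec_eq {m q : Multisegment n} {l : ℕ+} {i : ZMod n} (h : Extends m l i q)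
    (j : ZMod n) : dimVec q j = dimVec m j + if i = j then 1 else 0 := by
  have h1 := h.segSum_add (fun k i' => cellCount k i' j) rfl
  have h2 := cellCount_succ ((l : ℕ) - 1) i j
  rw [Nat.sub_add_cancel l.pos] at h2
  rw [← CyclicHall.dimVec_eq, ← CyclicHall.dimVec_eq, h2] at h1
  push_cast at h1
  have : (dimVec q j : ℤ) = (dimVec m j + if i = j then 1 else 0 : ℕ) := by
    push_cast
    linarith
  exact_mod_cast this

/-- The multiplicity of the segments with head at `i` and length at least `l`. -/
def tailCount (m : Multisegment n) (l : ℕ) (i : ZMod n) : ℤ :=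
  segSum (fun s => if s.2 = i ∧ l ≤ (s.1 : ℕ) then 1 else 0) m

/-- The change of `dim End(k[m])` under lengthening a segment.  The double sum of `homCount` is
compared in one variable at a time. -/
theorem Extends.card_homIdx {m q : Multisegment n} {l : ℕ+} {i : ZMod n} (h : Extends m l i q) :
    (Fintype.card (HomIdx q) : ℤ) = Fintype.card (HomIdx m) + dimVec m i - dimVec m (i - 1) + 1 +
      tailCount m l i + tailCount m l (i - 1) := by
  obtain ⟨l', hl'⟩ : ∃ l', (l : ℕ) = l' + 1 := ⟨(l : ℕ) - 1, (Nat.sub_add_cancel l.pos).symm⟩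
  let D₂ (k : ℕ) (j : ZMod n) : ℤ := if j = i ∧ l' + 1 ≤ k then 1 else 0
  have inner (k : ℕ) (j : ZMod n) :
      segSum (fun s => (homCount (s.1 : ℕ) s.2 k j : ℤ)) q =
        segSum (fun s => (homCount (s.1 : ℕ) s.2 k j : ℤ)) m + homCount (l' + 1) i k j -
          homCount l' (i - 1) k j := by
    have := h.segSum_add (fun k' j' => homCount k' j' k j) (by simp [homCount_zero_left])
    rwa [hl', Nat.add_sub_cancel] at this
  have outer := h.segSum_add (fun k j => segSum (fun s => (homCount (s.1 : ℕ) s.2 k j : ℤ)) q)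
    (by simp [homCount_zero_right, Finsupp.linearCombination_apply])
  have hD₂ : segSum (fun s => (homCount (s.1 : ℕ) s.2 (l' + 1) i : ℤ)) q =
      segSum (fun s => (homCount (s.1 : ℕ) s.2 l' (i - 1) : ℤ)) q + tailCount m l i + 1 := by
    have h1 : segSum (fun s => (homCount (s.1 : ℕ) s.2 (l' + 1) i : ℤ)) q =
      segSum (fun s => (homCount (s.1 : ℕ) s.2 l' (i - 1) : ℤ)) q +
        segSum (fun s => D₂ (s.1 : ℕ) s.2) q := by
      simp only [segSum, Finsupp.linearCombination_apply, Finsupp.sum, ← Finset.sum_add_distrib,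
        ← smul_add]
      refine Finset.sum_congr rfl fun s _ => ?_
      rw [homCount_succ_right]
      push_cast
      rfl
    have h2 := h.segSum_add D₂ (by simp [D₂])
    rw [h1, h2, tailCount, hl']
    simp [D₂]
    ring
  rw [hl', Nat.add_sub_cancel, hD₂] at outer
  rw [CyclicHall.card_homIdx, CyclicHall.card_homIdx, outer, CyclicHall.dimVec_eq,
    CyclicHall.dimVec_eq, tailCount, tailCount, hl']
  have key : segSum (fun s' => segSum (fun s =>
        (homCount (s.1 : ℕ) s.2 (s'.1 : ℕ) s'.2 : ℤ)) q) m +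
      segSum (fun s => (cellCount (s.1 : ℕ) s.2 (i - 1) : ℤ)) m =
      segSum (fun s' => segSum (fun s =>
        (homCount (s.1 : ℕ) s.2 (s'.1 : ℕ) s'.2 : ℤ)) m) m +
      segSum (fun s => (cellCount (s.1 : ℕ) s.2 i : ℤ)) m +
      segSum (fun s => if s.2 = i - 1 ∧ l' + 1 ≤ (s.1 : ℕ) then (1 : ℤ) else 0) m := by
    rw [← segSum_add_apply, ← segSum_add_apply, ← segSum_add_apply]
    congr 2
    funext s
    rw [inner]
    have h1 := homCount_succ_left l' i s.1 s.1.pos s.2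
    have h2 := cellCount_add s.1 s.2 i
    have h3 : (if s.2 = i - 1 then 1 else 0) = (if s.2 = i - 1 ∧ (s.1 : ℕ) ≤ l' then 1 else 0) +
      if s.2 = i - 1 ∧ l' + 1 ≤ (s.1 : ℕ) then 1 else 0 := by
      by_cases h4 : s.2 = i - 1 <;> by_cases h5 : (s.1 : ℕ) ≤ l' <;> simp [h4, h5]
    have h1' := congrArg (Nat.cast (R := ℤ)) h1
    have h2' := congrArg (Nat.cast (R := ℤ)) h2
    have h3' := congrArg (Nat.cast (R := ℤ)) h3
    simp only [Nat.cast_add, Nat.cast_ite, Nat.cast_one, Nat.cast_zero] at h1' h2' h3'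
    linarith
  linarith

variable [NeZero n]

theorem orbitDim_eq (m : Multisegment n) :
    (orbitDim m : ℤ) = ∑ j, (dimVec m j : ℤ) ^ 2 - Fintype.card (HomIdx m) := by
  have := orbitDim_add_finrank_commutant (m := m)
  rw [finrank_commutant] at this
  rw [eq_sub_iff_add_eq]
  exact_mod_cast this

/-- The change of the orbit dimension under lengthening a segment. -/
theorem Extends.orbitDim_eq {m q : Multisegment n} {l : ℕ+} {i : ZMod n} (h : Extends m l i q) :
    (orbitDim q : ℤ) = orbitDim m + dimVec m i + dimVec m (i - 1) - tailCount m l i -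
      tailCount m l (i - 1) := by
  rw [CyclicHall.orbitDim_eq, CyclicHall.orbitDim_eq, h.card_homIdx]
  have h1 : ∑ j, (dimVec q j : ℤ) ^ 2 = ∑ j, (dimVec m j : ℤ) ^ 2 + (2 * dimVec m i + 1) := by
    have h2 (j : ZMod n) : (dimVec q j : ℤ) ^ 2 =
        (dimVec m j : ℤ) ^ 2 + if i = j then 2 * (dimVec m j : ℤ) + 1 else 0 := by
      rw [h.dimVec_eq]
      split_ifs <;> push_cast <;> ring
    simp_rw [h2, Finset.sum_add_distrib, Finset.sum_ite_eq, Finset.mem_univ, if_true]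
  rw [h1]
  ring

omit [NeZero n] in
theorem extends_zero (i : ZMod n) : Extends 0 1 i (Finsupp.single (1, i) 1) :=
  Or.inl ⟨rfl, (zero_add _).symm⟩

omit [NeZero n] in
theorem dimVec_simple (i j : ZMod n) :
    dimVec (Finsupp.single (1, i) 1 : Multisegment n) j = if i = j then 1 else 0 := by
  have h0 : dimVec (0 : Multisegment n) j = 0 := by
    have := CyclicHall.dimVec_eq (0 : Multisegment n) j
    rw [map_zero] at this
    exact_mod_cast this
  rw [(extends_zero i).dimVec_eq, h0, zero_add]

theorem orbitDim_simple (i : ZMod n) :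
    orbitDim (Finsupp.single (1, i) 1 : Multisegment n) = 0 := by
  have h : (orbitDim (Finsupp.single (1, i) 1 : Multisegment n) : ℤ) = 0 := by
    rw [(extends_zero i).orbitDim_eq, CyclicHall.orbitDim_eq]
    simp [CyclicHall.dimVec_eq, tailCount]
  exact_mod_cast h

end Counting

/-! ### Invariants of the isomorphism class of a representation -/

section Iso

variable {n : ℕ} {k : Type} [Field k]

theorem Rep.Iso.symm {M N : Rep n k} (h : M.Iso N) : N.Iso M := by
  obtain ⟨e, he⟩ := h
  refine ⟨fun j => (e j).symm, fun j w => ?_⟩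
  rw [LinearEquiv.symm_apply_eq, he, LinearEquiv.apply_symm_apply]

theorem Rep.Iso.trans {M N L : Rep n k} (h : M.Iso N) (h' : N.Iso L) : M.Iso L := by
  obtain ⟨e, he⟩ := h
  obtain ⟨e', he'⟩ := h'
  refine ⟨fun j => (e j).trans (e' j), fun j w => ?_⟩
  rw [LinearEquiv.trans_apply, LinearEquiv.trans_apply, he, he']

/-- The vectors killed by the composition of `c` consecutive arrows. -/
def Rep.killed (M : Rep n k) : ℕ → ∀ j, Submodule k (M.V j)
  | 0, _ => ⊥
  | c + 1, j => (M.killed c (j - 1)).comap (M.x j)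

/-- For a finite-dimensional nilpotent representation, the number of indecomposable summands with
head at the vertex `j - 1` and length greater than `c`. -/
def Rep.headDim (M : Rep n k) (c : ℕ) (j : ZMod n) : ℕ :=
  Module.finrank k (M.V (j - 1) ⧸ (LinearMap.range (M.x j) ⊔ M.killed c (j - 1)))

theorem Rep.Iso.headDim_eq {M N : Rep n k} (h : M.Iso N) (c : ℕ) (j : ZMod n) :
    M.headDim c j = N.headDim c j := by
  obtain ⟨e, he⟩ := h
  have hk (c : ℕ) : ∀ (j : ZMod n) (w : M.V j), e j w ∈ N.killed c j ↔ w ∈ M.killed c j := by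
    induction c with
    | zero => intro j w; simp [Rep.killed]
    | succ c ih =>
      intro j w
      rw [Rep.killed, Rep.killed, Submodule.mem_comap, Submodule.mem_comap, ← he, ih]
  refine (Submodule.Quotient.equiv _ _ (e (j - 1)) ?_).finrank_eq
  have h1 : (LinearMap.range (M.x j)).map (e (j - 1)).toLinearMap = LinearMap.range (N.x j) := by
    ext w
    constructor
    · rintro ⟨_, ⟨w, rfl⟩, rfl⟩
      exact ⟨e j w, (he j w).symm⟩
    · rintro ⟨w, rfl⟩
      exact ⟨_, ⟨(e j).symm w, rfl⟩, by simp [he]⟩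
  have h2 : (M.killed c (j - 1)).map (e (j - 1)).toLinearMap = N.killed c (j - 1) := by
    ext w
    constructor
    · rintro ⟨w, hw, rfl⟩
      exact (hk c _ w).mpr hw
    · intro hw
      exact ⟨(e (j - 1)).symm w, (hk c _ _).mp (by simpa using hw), by simp⟩
  rw [Submodule.map_sup, h1, h2]

end Iso

/-! ### Families of segments -/

section Family

variable {n : ℕ} (k : Type) [Field k] {ι : Type} (len : ι → ℕ) (head : ι → ZMod n)

/-- The direct sum of the indecomposable modules of length `len p` and head at the vertex `head p`,
where length `0` is allowed.  A vector at the vertex `j` is a function of the segment and the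
position, which vanishes at the positions outside the segment or not at the vertex `j`. -/
def famRep : Rep n k where
  V j := ({ carrier := {w | ∀ p c, ¬(c < len p ∧ head p - (c : ZMod n) = j) → w p c = 0}
            add_mem' := fun {w w'} h h' p c hc => by simp [h p c hc, h' p c hc]
            zero_mem' := fun _ _ _ => rfl
            smul_mem' := fun a w h p c hc => by simp [h p c hc] } : Submodule k (ι → ℕ → k))
  x j :=
    { toFun := fun w => ⟨fun p c => if 0 < c ∧ c < len p then w.1 p (c - 1) else 0, fun p c hc => by
        dsimp only
        split_ifs with h
        · refine w.2 p (c - 1) fun h' => hc ⟨h.2, ?_⟩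
          rw [← h'.2, Nat.cast_sub h.1, Nat.cast_one]
          ring
        · rfl⟩
      map_add' := fun w w' => Subtype.ext (funext fun p => funext fun c => by
        by_cases h : 0 < c ∧ c < len p <;> simp [h])
      map_smul' := fun a w => Subtype.ext (funext fun p => funext fun c => by
        by_cases h : 0 < c ∧ c < len p <;> simp [h]) }

variable {k len head}

theorem famRep_apply_eq_zero {j : ZMod n} (w : (famRep k len head).V j) {p : ι} {c : ℕ}
    (h : ¬(c < len p ∧ head p - (c : ZMod n) = j)) : w.1 p c = 0 :=
  w.2 p c h

theorem famRep_ext {j : ZMod n} {w w' : (famRep k len head).V j}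
    (h : ∀ p c, w.1 p c = w'.1 p c) : w = w' :=
  Subtype.ext (funext fun p => funext fun c => h p c)

theorem famRep_x_apply {j : ZMod n} (w : (famRep k len head).V j) (p : ι) (c : ℕ) :
    ((famRep k len head).x j w).1 p c = if 0 < c ∧ c < len p then w.1 p (c - 1) else 0 :=
  rfl

theorem mem_killed_famRep (c : ℕ) : ∀ (j : ZMod n) (w : (famRep k len head).V j),
    w ∈ (famRep k len head).killed c j ↔ ∀ p d, d + c < len p → w.1 p d = 0 := by
  induction c with
  | zero =>
    intro j w
    rw [Rep.killed, Submodule.mem_bot]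
    constructor
    · rintro rfl p d _
      rfl
    · refine fun h => famRep_ext fun p d => ?_
      by_cases hd : d < len p
      · exact h p d hd
      · exact famRep_apply_eq_zero w fun h' => hd h'.1
  | succ c ih =>
    intro j w
    rw [Rep.killed, Submodule.mem_comap, ih]
    constructor
    · intro h p d hd
      have := h p (d + 1) (by omega)
      rwa [famRep_x_apply, if_pos (by omega), Nat.add_sub_cancel] at this
    · intro h p d hd
      rw [famRep_x_apply]
      split_ifs with hd'
      · exact h p (d - 1) (by omega)
      · rfl

/-- The quotient defining `headDim` is given by the coefficients on the heads of the segments of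
length greater than `c`. -/
theorem headDim_famRep [Fintype ι] (c : ℕ) (j : ZMod n) :
    (famRep k len head).headDim c j = Nat.card {p // head p = j - 1 ∧ c < len p} := by
  classical
  let T : (famRep k len head).V (j - 1) →ₗ[k] {p // head p = j - 1 ∧ c < len p} → k :=
    { toFun := fun w p => w.1 p.1 0
      map_add' := fun _ _ => rfl
      map_smul' := fun _ _ => rfl }
  have hT : Function.Surjective T := by
    intro z
    refine ⟨⟨fun p d => if h : (head p = j - 1 ∧ c < len p) ∧ d = 0 then z ⟨p, h.1⟩ else 0,
      fun p d hd => dif_neg ?_⟩, funext fun p => ?_⟩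
    · rintro ⟨⟨h1, h2⟩, rfl⟩
      exact hd ⟨by omega, by simpa using h1⟩
    · exact dif_pos ⟨p.2, rfl⟩
  have hker : LinearMap.ker T = LinearMap.range ((famRep k len head).x j) ⊔
      (famRep k len head).killed c (j - 1) := by
    refine le_antisymm (fun w hw => ?_) (sup_le ?_ ?_)
    · have hw0 (p : ι) (hp : c < len p) : w.1 p 0 = 0 := by
        by_cases h : head p = j - 1
        · exact congrFun (LinearMap.mem_ker.mp hw) ⟨p, h, hp⟩
        · exact famRep_apply_eq_zero w fun h' => h (by simpa using h'.2)
      refine Submodule.mem_sup.mpr ⟨_, ⟨⟨fun p d => if d + 1 < len p then w.1 p (d + 1) else 0,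
        fun p d hd => ?_⟩, rfl⟩, ⟨fun p d => if d = 0 then w.1 p 0 else 0, fun p d hd => ?_⟩,
        ?_, ?_⟩
      · dsimp only
        split_ifs with h
        · refine famRep_apply_eq_zero w fun h' => hd ⟨by omega, ?_⟩
          have := h'.2
          push_cast at this
          linear_combination this
        · rfl
      · dsimp only
        split_ifs with h
        · subst h
          exact famRep_apply_eq_zero w hd
        · rfl
      · refine (mem_killed_famRep c _ _).mpr fun p d hd => ?_
        change (if d = 0 then w.1 p 0 else 0) = 0
        split_ifs with h
        · exact hw0 p (by omega)
        · rfl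
      · refine famRep_ext fun p d => ?_
        change (if 0 < d ∧ d < len p then
          (if d - 1 + 1 < len p then w.1 p (d - 1 + 1) else 0) else 0) +
            (if d = 0 then w.1 p 0 else 0) = w.1 p d
        rcases Nat.eq_zero_or_pos d with rfl | hd
        · simp
        · rw [Nat.sub_add_cancel hd, if_neg hd.ne', add_zero]
          by_cases hd' : d < len p
          · rw [if_pos ⟨hd, hd'⟩, if_pos hd']
          · rw [if_neg fun h => hd' h.2]
            exact (famRep_apply_eq_zero w fun h => hd' h.1).symm
    · rintro _ ⟨w, rfl⟩
      refine LinearMap.mem_ker.mpr (funext fun p => ?_)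
      change (if 0 < 0 ∧ 0 < len p.1 then w.1 p.1 (0 - 1) else 0) = 0
      simp
    · intro w hw
      rw [mem_killed_famRep] at hw
      exact LinearMap.mem_ker.mpr (funext fun p => hw p.1 0 (by simpa using p.2.2))
  rw [Rep.headDim, ← hker, (LinearMap.quotKerEquivOfSurjective T hT).finrank_eq,
    Module.finrank_fintype_fun_eq_card, Nat.card_eq_fintype_card]

/-- A family of segments yields the module `k[m]` if, apart from segments of length `0`, it can be
indexed by the individual segments of `m`. -/
theorem famRep_iso_stdRep_of_injective {m : Multisegment n} (f : Copy m → ι)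
    (hf : Function.Injective f) (hlen : ∀ p, len (f p) = p.len) (hhead : ∀ p, head (f p) = p.head)
    (hsurj : ∀ p, 0 < len p → p ∈ Set.range f) : (famRep k len head).Iso (stdRep k m) := by
  classical
  let T (j : ZMod n) : (famRep k len head).V j →ₗ[k] Cell m j → k :=
    { toFun := fun w a => w.1 (f a.1) a.pos
      map_add' := fun _ _ => rfl
      map_smul' := fun _ _ => rfl }
  have hT (j : ZMod n) : Function.Bijective (T j) := by
    constructor
    · refine (injective_iff_map_eq_zero _).mpr fun w hw => famRep_ext fun p c => ?_
      by_cases h : c < len p ∧ head p - (c : ZMod n) = j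
      · obtain ⟨p, rfl⟩ := hsurj p (by omega)
        rw [hlen, hhead] at h
        exact congrFun hw (p.cell c h.1 h.2)
      · exact famRep_apply_eq_zero w h
    · intro z
      refine ⟨⟨fun p c => if h : ∃ a : Cell m j, f a.1 = p ∧ a.pos = c then z h.choose else 0,
        fun p c hc => dif_neg ?_⟩, funext fun a => ?_⟩
      · rintro ⟨a, rfl, rfl⟩
        refine hc ?_
        rw [hlen, hhead]
        exact ⟨a.pos_lt, a.head_sub_pos⟩
      · have h : ∃ a' : Cell m j, f a'.1 = f a.1 ∧ a'.pos = a.pos := ⟨a, rfl, rfl⟩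
        refine (dif_pos h).trans (congrArg z ?_)
        exact Cell.ext (hf h.choose_spec.1) h.choose_spec.2
  refine ⟨fun j => LinearEquiv.ofBijective (T j) (hT j), fun j w => funext fun b => ?_⟩
  have h := sum_shift_mul (fun a : Cell m j => w.1 (f a.1) a.pos) b
  refine Eq.trans ?_ h.symm
  change (if 0 < b.pos ∧ b.pos < len (f b.1) then w.1 (f b.1) (b.pos - 1) else 0) = _
  have hb : b.pos < len (f b.1) := by rw [hlen]; exact b.pos_lt
  split_ifs with h1 h2 h2
  · rfl
  · exact absurd h1.1 h2
  · exact absurd ⟨h2, hb⟩ h1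
  · rfl

/-- A family of segments yields the module `k[m]` if `m` gives the multiplicities of the segments of
positive length in the family. -/
theorem famRep_iso_stdRep [Fintype ι] {m : Multisegment n}
    (h : ∀ s : Segment n, Nat.card {p // len p = (s.1 : ℕ) ∧ head p = s.2} = m s) :
    (famRep k len head).Iso (stdRep k m) := by
  classical
  have e (s : Segment n) : Nonempty (Fin (m s) ≃ {p // len p = (s.1 : ℕ) ∧ head p = s.2}) :=
    ⟨(Finite.equivFinOfCardEq (h s)).symm⟩
  let f (p : Copy m) : ι := ((e p.1.1).some p.2).1
  have hf (p : Copy m) : len (f p) = p.len ∧ head (f p) = p.head := ((e p.1.1).some p.2).2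
  refine famRep_iso_stdRep_of_injective f ?_ (fun p => (hf p).1) (fun p => (hf p).2) ?_
  · intro p p' hp
    have h1 : p.1.1.1 = p'.1.1.1 := PNat.coe_injective (by
      have := (hf p).1
      rw [hp, (hf p').1] at this
      exact this.symm)
    have h2 : p.1.1.2 = p'.1.1.2 := by
      have := (hf p).2
      rw [hp, (hf p').2] at this
      exact this.symm
    have h3 : p.1 = p'.1 := Subtype.ext (Prod.ext h1 h2)
    obtain ⟨s, x⟩ := p
    obtain ⟨s', x'⟩ := p'
    obtain rfl : s = s' := h3
    have := (e s.1).some.injective (Subtype.ext hp)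
    exact congrArg (Sigma.mk s) this
  · intro p hp
    let s : Segment n := (⟨len p, hp⟩, head p)
    let x := (e s).some.symm ⟨p, rfl, rfl⟩
    have hs : s ∈ m.support := by
      rw [Finsupp.mem_support_iff]
      have := x.pos
      omega
    refine ⟨⟨⟨s, hs⟩, x⟩, ?_⟩
    change ((e s).some ((e s).some.symm _)).1 = p
    rw [Equiv.apply_symm_apply]

end Family

section Multiplicities

variable {n : ℕ} {k : Type} [Field k]

theorem segSum_eq_apply (m : Multisegment n) (s : Segment n) :
    segSum (fun s' => if s' = s then 1 else 0) m = m s := by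
  classical
  rw [segSum, Finsupp.linearCombination_apply, Finsupp.sum]
  simp only [smul_ite, smul_zero, Finset.sum_ite_eq', Finsupp.mem_support_iff]
  split_ifs with h
  · simp
  · simp only [not_not] at h
    simp [h]

theorem tailCount_eq (m : Multisegment n) (l : ℕ+) (i : ZMod n) :
    tailCount m l i = m (l, i) + tailCount m (l + 1) i := by
  rw [tailCount, tailCount, ← segSum_eq_apply, ← segSum_add_apply]
  congr 2
  funext s
  have : s = (l, i) ↔ (s.1 : ℕ) = l ∧ s.2 = i := by
    rw [Prod.ext_iff, PNat.coe_inj]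
  by_cases h1 : s.2 = i
  · rcases lt_trichotomy (s.1 : ℕ) (l : ℕ) with h2 | h2 | h2
    · simp [this, h1, h2.ne, h2.not_ge, show ¬ (l : ℕ) + 1 ≤ s.1 by omega]
    · simp [this, h1, h2]
    · simp [this, h1, h2.ne', h2.le, show (l : ℕ) + 1 ≤ s.1 by omega]
  · simp [this, h1]

theorem card_copy_subtype (m : Multisegment n) (P : ℕ → ZMod n → Prop)
    [∀ a b, Decidable (P a b)] :
    (Nat.card {p : Copy m // P p.len p.head} : ℤ) =
      segSum (fun s => if P s.1 s.2 then 1 else 0) m := by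
  classical
  rw [← sum_copy, Nat.card_eq_fintype_card, Fintype.card_subtype, Finset.card_filter]
  push_cast
  rfl

theorem tailCount_eq_card (m : Multisegment n) (l : ℕ) (i : ZMod n) :
    tailCount m l i = Nat.card {p : Copy m // p.head = i ∧ l ≤ p.len} :=
  (card_copy_subtype m fun a b => b = i ∧ l ≤ a).symm

theorem stdRep_iso_famRep (m : Multisegment n) :
    (stdRep k m).Iso (famRep k (Copy.len (m := m)) Copy.head) :=
  (famRep_iso_stdRep_of_injective id Function.injective_id (fun _ => rfl) (fun _ => rfl)
    fun p _ => ⟨p, rfl⟩).symm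

/-- The modules `k[m]` are pairwise non-isomorphic. -/
theorem eq_of_stdRep_iso {m m' : Multisegment n} (h : (stdRep k m).Iso (stdRep k m')) :
    m = m' := by
  have htail (l : ℕ) (i : ZMod n) : tailCount m (l + 1) i = tailCount m' (l + 1) i := by
    have := (((stdRep_iso_famRep m).symm.trans h).trans (stdRep_iso_famRep m')).headDim_eq
      l (i + 1)
    rw [headDim_famRep, headDim_famRep, add_sub_cancel_right] at this
    rw [tailCount_eq_card, tailCount_eq_card]
    exact_mod_cast this
  ext ⟨l, i⟩
  have h1 := tailCount_eq m l i
  have h2 := tailCount_eq m' l i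
  have h3 := htail ((l : ℕ) - 1) i
  rw [Nat.sub_add_cancel l.pos] at h3
  rw [h3, htail] at h1
  have : (m (l, i) : ℤ) = m' (l, i) := by linarith
  exact_mod_cast this

/-- If `q` arises from `m` by lengthening a segment to `(l;i]`, then deleting the head of a segment
`t` of type `(l;i]` in `k[q]` yields `k[m]`. -/
theorem Extends.famRep_iso {m q : Multisegment n} {l : ℕ+} {i : ZMod n} (h : Extends m l i q)
    (t : Copy q) (htl : t.len = l) (hti : t.head = i) :
    (famRep k (Function.update Copy.len t ((l : ℕ) - 1))
      (Function.update Copy.head t (i - 1))).Iso (stdRep k m) := by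
  refine famRep_iso_stdRep fun s => ?_
  let f (a : ℕ) (b : ZMod n) : ℤ := if a = (s.1 : ℕ) ∧ b = s.2 then 1 else 0
  have h1 := h.segSum_add f (by simp [f, s.1.pos.ne])
  have h2 : segSum (fun s' => f (s'.1 : ℕ) s'.2) m = m s := by
    rw [← segSum_eq_apply]
    congr 2
    funext s'
    simp [f, Prod.ext_iff]
  have h3 : (Nat.card {p // Function.update Copy.len t ((l : ℕ) - 1) p = (s.1 : ℕ) ∧
      Function.update Copy.head t (i - 1) p = s.2} : ℤ) =
      ∑ p, f (Function.update Copy.len t ((l : ℕ) - 1) p) (Function.update Copy.head t (i - 1) p)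
      := by
    rw [Nat.card_eq_fintype_card, Fintype.card_subtype, Finset.card_filter]
    push_cast
    rfl
  have h4 : ∑ p, f (Function.update Copy.len t ((l : ℕ) - 1) p)
      (Function.update Copy.head t (i - 1) p) + f l i =
      ∑ p : Copy q, f p.len p.head + f ((l : ℕ) - 1) (i - 1) := by
    rw [← Finset.add_sum_erase _ _ (Finset.mem_univ t),
      ← Finset.add_sum_erase _ (fun p : Copy q => f p.len p.head) (Finset.mem_univ t)]
    have : ∀ p ∈ Finset.univ.erase t, f (Function.update Copy.len t ((l : ℕ) - 1) p)
      (Function.update Copy.head t (i - 1) p) = f p.len p.head := by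
      intro p hp
      rw [Function.update_of_ne (Finset.ne_of_mem_erase hp),
        Function.update_of_ne (Finset.ne_of_mem_erase hp)]
    rw [Finset.sum_congr rfl this, Function.update_self, Function.update_self, htl, hti]
    ring
  rw [sum_copy q (fun s' => f (s'.1 : ℕ) s'.2)] at h4
  have : (Nat.card {p // Function.update Copy.len t ((l : ℕ) - 1) p = (s.1 : ℕ) ∧
      Function.update Copy.head t (i - 1) p = s.2} : ℤ) = m s := by
    rw [← h2, h3]
    linarith
  exact_mod_cast this

end Multiplicities

/-! ### Maximal submodules of `k[q]` with simple quotient at a given vertex -/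

section HeadForms

variable {n : ℕ} {k : Type} [Field k] {q : Multisegment n}

variable (k q) in
/-- A vector of `k[q]` at the vertex `j` as a function of the segment and the position, extended
by `0`. -/
def extend (j : ZMod n) : (stdRep k q).V j →ₗ[k] Copy q → ℕ → k :=
  LinearMap.pi fun p => LinearMap.pi fun c =>
    if h : c < p.len ∧ p.head - (c : ZMod n) = j then
      (LinearMap.proj (p.cell c h.1 h.2) : (Cell q j → k) →ₗ[k] k) else 0

/-- The coordinate of a vector of `k[q]` at a basis vector. -/
def coordAt {j : ZMod n} (w : (stdRep k q).V j) (a : Cell q j) : k := (w : Cell q j → k) a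

theorem extend_of_mem {j : ZMod n} (w : (stdRep k q).V j) {p : Copy q} {c : ℕ}
    (h : c < p.len ∧ p.head - (c : ZMod n) = j) :
    extend k q j w p c = coordAt w (p.cell c h.1 h.2) := by
  change (if h : c < p.len ∧ p.head - (c : ZMod n) = j then
      (LinearMap.proj (p.cell c h.1 h.2) : (Cell q j → k) →ₗ[k] k) else 0) w = _
  rw [dif_pos h]
  rfl

theorem extend_cell {j : ZMod n} (w : (stdRep k q).V j) (a : Cell q j) :
    extend k q j w a.1 a.pos = coordAt w a :=
  extend_of_mem w ⟨a.pos_lt, a.head_sub_pos⟩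

theorem extend_eq_zero {j : ZMod n} (w : (stdRep k q).V j) {p : Copy q} {c : ℕ}
    (h : ¬(c < p.len ∧ p.head - (c : ZMod n) = j)) : extend k q j w p c = 0 := by
  change (if h : c < p.len ∧ p.head - (c : ZMod n) = j then
      (LinearMap.proj (p.cell c h.1 h.2) : (Cell q j → k) →ₗ[k] k) else 0) w = _
  rw [dif_neg h]
  rfl

theorem extend_injective (j : ZMod n) : Function.Injective (extend k q j) := by
  intro w w' h
  funext a
  have := congrFun (congrFun h a.1) a.pos
  rwa [extend_cell, extend_cell] at this

theorem exists_extend_eq (j : ZMod n) (W : Copy q → ℕ → k)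
    (hW : ∀ p (c : ℕ), ¬(c < p.len ∧ p.head - (c : ZMod n) = j) → W p c = 0) :
    ∃ w, extend k q j w = W := by
  refine ⟨fun a : Cell q j => W a.1 a.pos, ?_⟩
  funext p c
  by_cases h : c < p.len ∧ p.head - (c : ZMod n) = j
  · exact extend_of_mem _ h
  · exact (extend_eq_zero _ h).trans (hW p c h).symm

theorem extend_x {j : ZMod n} (w : (stdRep k q).V j) (p : Copy q) (c : ℕ) :
    extend k q (j - 1) ((stdRep k q).x j w) p c =
      if 0 < c ∧ c < p.len then extend k q j w p (c - 1) else 0 := by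
  classical
  by_cases h : c < p.len ∧ p.head - (c : ZMod n) = j - 1
  · have h1 := sum_shift_mul (w : Cell q j → k) (p.cell c h.1 h.2)
    have h2 := extend_cell ((stdRep k q).x j w) (p.cell c h.1 h.2)
    refine (h2.trans h1).trans ?_
    change (if h' : 0 < c then w ((p.cell c h.1 h.2).prev h') else 0) = _
    by_cases hc : 0 < c
    · rw [dif_pos hc, if_pos ⟨hc, h.1⟩]
      exact (extend_cell w ((p.cell c h.1 h.2).prev hc)).symm
    · rw [dif_neg hc, if_neg fun h' => hc h'.1]
  · rw [extend_eq_zero _ h]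
    split_ifs with h'
    · refine (extend_eq_zero _ fun h'' => h ⟨h'.2, ?_⟩).symm
      rw [← h''.2, Nat.cast_sub h'.1, Nat.cast_one]
      ring
    · rfl

/-- The linear form on `k[q]` at the vertex `j` with coefficients `φ` on the heads of the segments
and `0` on the other basis vectors. -/
def headForm (φ : Copy q → k) (j : ZMod n) : (stdRep k q).V j →ₗ[k] k where
  toFun w := ∑ p, φ p * extend k q j w p 0
  map_add' w w' := by
    simp only [map_add, Pi.add_apply, mul_add, Finset.sum_add_distrib]
  map_smul' a w := by
    simp only [map_smul, Pi.smul_apply, smul_eq_mul, RingHom.id_apply, Finset.mul_sum]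
    exact Finset.sum_congr rfl fun p _ => by ring

theorem headForm_apply (φ : Copy q → k) (j : ZMod n) (w : (stdRep k q).V j) :
    headForm φ j w = ∑ p, φ p * extend k q j w p 0 := rfl

theorem headForm_x (φ : Copy q → k) (j : ZMod n) (w : (stdRep k q).V j) :
    headForm φ (j - 1) ((stdRep k q).x j w) = 0 := by
  rw [headForm_apply]
  refine Finset.sum_eq_zero fun p _ => ?_
  rw [extend_x, if_neg (by simp), mul_zero]

/-- The submodule of `k[q]` which is the kernel of the linear form with coefficients `φ` on the
heads. -/
def headSub (φ : Copy q → k) : Subrep (stdRep k q) where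
  carrier j := LinearMap.ker (headForm φ j)
  map_mem j w _ := LinearMap.mem_ker.mpr (headForm_x φ j w)

theorem mem_headSub {φ : Copy q → k} {j : ZMod n} {w : (stdRep k q).V j} :
    w ∈ (headSub φ).carrier j ↔ ∑ p, φ p * extend k q j w p 0 = 0 := Iff.rfl

variable (k) in
/-- The basis vector of `k[q]` labelled by `a`. -/
def basisVec {j : ZMod n} (a : Cell q j) : (stdRep k q).V j :=
  (Pi.single a 1 : Cell q j → k)

theorem extend_basisVec {j : ZMod n}
    (a : Cell q j) (p : Copy q) (c : ℕ) :
    extend k q j (basisVec k a) p c = if p = a.1 ∧ c = a.pos then 1 else 0 := by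
  by_cases h : c < p.len ∧ p.head - (c : ZMod n) = j
  · rw [extend_of_mem _ h]
    refine (Pi.single_apply a (1 : k) _).trans (if_congr ⟨?_, ?_⟩ rfl rfl)
    · rintro rfl
      exact ⟨rfl, rfl⟩
    · exact fun h' => Cell.ext h'.1 h'.2
  · rw [extend_eq_zero _ h, if_neg]
    rintro ⟨rfl, rfl⟩
    exact h ⟨a.pos_lt, a.head_sub_pos⟩

variable (k) in
/-- The basis vector of `k[q]` belonging to the head of the segment `p`. -/
def headVec (p : Copy q) {j : ZMod n} (hj : p.head = j) : (stdRep k q).V j :=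
  basisVec k (p.cell 0 p.1.1.1.pos (by simpa using hj))

theorem extend_headVec (p : Copy q) {j : ZMod n} (hj : p.head = j) (p' : Copy q) (c : ℕ) :
    extend k q j (headVec k p hj) p' c = if p' = p ∧ c = 0 then 1 else 0 :=
  extend_basisVec _ p' c

theorem headForm_headVec (φ : Copy q → k) (p : Copy q) {j : ZMod n}
    (hj : p.head = j) : headForm φ j (headVec k p hj) = φ p := by
  rw [headForm_apply]
  simp [extend_headVec]

theorem Subrep.ext {M : Rep n k} {N N' : Subrep M} (h : ∀ j, N.carrier j = N'.carrier j) :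
    N = N' := by
  obtain ⟨c, hc⟩ := N
  obtain ⟨c', hc'⟩ := N'
  obtain rfl : c = c' := funext h
  rfl

theorem headSub_smul (φ : Copy q → k) {a : k} (ha : a ≠ 0) : headSub (a • φ) = headSub φ := by
  refine Subrep.ext fun j => Submodule.ext fun w => ?_
  rw [mem_headSub, mem_headSub]
  simp only [Pi.smul_apply, smul_eq_mul, mul_assoc, ← Finset.mul_sum, mul_eq_zero, ha, false_or]

/-- The linear form on the heads at `i` is determined by its kernel up to a scalar. -/
theorem eq_smul_of_headSub_eq {i : ZMod n} {φ ψ : Copy q → k} (hφ : ∀ p, φ p ≠ 0 → p.head = i)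
    (hψ : ∀ p, ψ p ≠ 0 → p.head = i) {t : Copy q} (ht : φ t ≠ 0)
    (h : headSub φ = headSub ψ) : ψ = (ψ t / φ t) • φ := by
  classical
  funext p
  by_cases hp : p.head = i
  · have h1 : headVec k p hp - (φ p / φ t) • headVec k t (hφ t ht) ∈ (headSub φ).carrier i := by
      refine LinearMap.mem_ker.mpr ?_
      rw [map_sub, map_smul, headForm_headVec, headForm_headVec, smul_eq_mul]
      field_simp
      ring
    rw [h] at h1
    have h2 := LinearMap.mem_ker.mp h1
    rw [map_sub, map_smul, headForm_headVec, headForm_headVec, smul_eq_mul, sub_eq_zero] at h2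
    rw [h2, Pi.smul_apply, smul_eq_mul]
    ring
  · have h1 : φ p = 0 := by by_contra h; exact hp (hφ p h)
    have h2 : ψ p = 0 := by by_contra h; exact hp (hψ p h)
    simp [h1, h2]

/-- If `t` is a shortest segment whose head has non-zero coefficient in `φ`, then `headSub φ` is
obtained from `k[q]` by deleting the head of `t`: the other summands of `k[q]` can be modified by
multiples of the summand `t` so that they lie in the kernel of `φ`. -/
theorem headSub_iso {i : ZMod n} {φ : Copy q → k}
    (hφ : ∀ p, φ p ≠ 0 → p.head = i) {t : Copy q} (ht : φ t ≠ 0)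
    (hmin : ∀ p, φ p ≠ 0 → t.len ≤ p.len) :
    (headSub φ).toRep.Iso (famRep k (Function.update Copy.len t (t.len - 1))
      (Function.update Copy.head t (i - 1))) := by
  set len' := Function.update (Copy.len (m := q)) t (t.len - 1) with hlen'
  set head' := Function.update (Copy.head (m := q)) t (i - 1) with hhead'
  have hti := hφ t ht
  have htpos : 0 < t.len := t.1.1.1.pos
  have hlt : len' t = t.len - 1 := Function.update_self ..
  have hht : head' t = i - 1 := Function.update_self ..
  have hlp (p) (hp : p ≠ t) : len' p = p.len := Function.update_of_ne hp ..
  have hhp (p) (hp : p ≠ t) : head' p = p.head := Function.update_of_ne hp ..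
  -- With respect to the summands `p - (φ p / φ t) t`, for `p ≠ t`, and `t`, the coefficients of a
  -- vector at `p ≠ t` are unchanged, and those at `t` become `(φ t)⁻¹ * ∑ p', φ p' * W p'`.  On the
  -- kernel of `φ` the latter vanish in position `0`, so the positions in `t` are shifted by `1`.
  let θ (W : Copy q → ℕ → k) (p : Copy q) (c : ℕ) : k :=
    if p = t then (if c + 1 < t.len then (φ t)⁻¹ * ∑ p', φ p' * W p' (c + 1) else 0) else W p c
  have hθ {j : ZMod n} (w : (stdRep k q).V j) (p : Copy q) (c : ℕ)
      (h : ¬(c < len' p ∧ head' p - (c : ZMod n) = j)) : θ (extend k q j w) p c = 0 := by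
    simp only [θ]
    split_ifs with hp hc
    · subst hp
      rw [hlt, hht] at h
      rw [Finset.sum_eq_zero, mul_zero]
      intro p' _
      by_cases hp' : φ p' = 0
      · rw [hp', zero_mul]
      · rw [extend_eq_zero, mul_zero]
        rintro ⟨_, h'⟩
        refine h ⟨by omega, ?_⟩
        rw [← h', hφ p' hp', Nat.cast_add, Nat.cast_one]
        ring
    · rfl
    · rw [hlp p hp, hhp p hp] at h
      exact extend_eq_zero w h
  let Θ (j : ZMod n) : (headSub φ).toRep.V j →ₗ[k] (famRep k len' head').V j :=
    { toFun := fun w => ⟨θ (extend k q j w.1), fun p c h => hθ w.1 p c h⟩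
      map_add' := fun w w' => famRep_ext fun p c => by
        change θ (extend k q j (w.1 + w'.1)) p c =
          θ (extend k q j w.1) p c + θ (extend k q j w'.1) p c
        simp only [θ, map_add, Pi.add_apply, mul_add, Finset.sum_add_distrib]
        split_ifs <;> simp
      map_smul' := fun a w => famRep_ext fun p c => by
        change θ (extend k q j (a • w.1)) p c = a * θ (extend k q j w.1) p c
        simp only [θ, map_smul, Pi.smul_apply, smul_eq_mul, mul_left_comm _ a, ← Finset.mul_sum]
        split_ifs <;> simp }
  have hΘ (j : ZMod n) (w : (headSub φ).toRep.V j) (p : Copy q) (c : ℕ) :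
    (Θ j w).1 p c = θ (extend k q j w.1) p c := rfl
  have hinj (j : ZMod n) : Function.Injective (Θ j) := by
    refine (injective_iff_map_eq_zero _).mpr fun w hw => Subtype.ext (extend_injective j ?_)
    have h0 (p : Copy q) (c : ℕ) : θ (extend k q j w.1) p c = 0 := by
      rw [← hΘ, hw]; rfl
    have hne (p : Copy q) (hp : p ≠ t) (c : ℕ) : extend k q j w.1 p c = 0 := by
      have := h0 p c
      rwa [show θ (extend k q j w.1) p c = _ from if_neg hp] at this
    have hsum (c : ℕ) : ∑ p, φ p * extend k q j w.1 p c = φ t * extend k q j w.1 t c := by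
      rw [Finset.sum_eq_single t]
      · intro p _ hp
        rw [hne p hp, mul_zero]
      · simp
    rw [show extend k q j (0 : (headSub φ).toRep.V j).1 = 0 from map_zero (extend k q j)]
    funext p c
    by_cases hp : p = t
    · subst hp
      rcases c with _ | c
      · have := mem_headSub.mp w.2
        rw [hsum] at this
        exact (mul_eq_zero.mp this).resolve_left ht
      · by_cases hc : c + 1 < p.len
        · have := h0 p c
          rw [show θ (extend k q j w.1) p c = _ from (if_pos rfl).trans (if_pos hc), hsum,
            inv_mul_cancel_left₀ ht] at this
          exact this
        · exact extend_eq_zero w.1 fun h => hc h.1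
    · exact hne p hp c
  have hsurj (j : ZMod n) : Function.Surjective (Θ j) := by
    intro w'
    -- The coefficients on `t` are found by solving the equations defining `θ`.
    let W (p : Copy q) (c : ℕ) : k :=
      if p = t then
        (if c < t.len then (if c = 0 then 0 else w'.1 t (c - 1)) -
          (φ t)⁻¹ * ∑ p' ∈ Finset.univ.erase t, φ p' * w'.1 p' c else 0)
      else w'.1 p c
    have hWne (p : Copy q) (hp : p ≠ t) (c : ℕ) : W p c = w'.1 p c := if_neg hp
    have hWt (c : ℕ) (hc : c < t.len) : W t c = (if c = 0 then 0 else w'.1 t (c - 1)) -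
        (φ t)⁻¹ * ∑ p' ∈ Finset.univ.erase t, φ p' * w'.1 p' c :=
      (if_pos rfl).trans (if_pos hc)
    have hsum (c : ℕ) (hc : c < t.len) :
        ∑ p, φ p * W p c = if c = 0 then 0 else φ t * w'.1 t (c - 1) := by
      rw [← Finset.add_sum_erase _ _ (Finset.mem_univ t), hWt c hc,
        Finset.sum_congr rfl fun p hp =>
          congrArg (φ p * ·) (hWne p (Finset.ne_of_mem_erase hp) c), mul_sub,
        mul_inv_cancel_left₀ ht, sub_add_cancel]
      simp
    obtain ⟨w, hw⟩ := exists_extend_eq (k := k) j W (by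
      intro p c h
      by_cases hp : p = t
      · subst hp
        by_cases hc : c < p.len
        · have hv : i - (c : ZMod n) ≠ j := fun h' => h ⟨hc, by rw [hti]; exact h'⟩
          rw [hWt c hc, Finset.sum_eq_zero, mul_zero, sub_zero]
          · split_ifs with hc0
            · rfl
            · refine famRep_apply_eq_zero w' ?_
              rw [hht]
              rintro ⟨_, h'⟩
              rw [Nat.cast_sub (Nat.pos_of_ne_zero hc0), Nat.cast_one] at h'
              exact hv (by rw [← h']; ring)
          · intro p' hp'
            by_cases hφp : φ p' = 0
            · rw [hφp, zero_mul]
            · rw [famRep_apply_eq_zero w', mul_zero]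
              rw [hhp p' (Finset.ne_of_mem_erase hp'), hφ p' hφp]
              exact fun h' => hv h'.2
        · exact (if_pos rfl).trans (if_neg hc)
      · rw [hWne p hp]
        refine famRep_apply_eq_zero w' ?_
        rwa [hlp p hp, hhp p hp])
    refine ⟨⟨w, mem_headSub.mpr ?_⟩, famRep_ext fun p c => ?_⟩
    · rw [hw, hsum 0 htpos, if_pos rfl]
    · change θ (extend k q j w) p c = _
      simp only [hw, θ]
      split_ifs with hp hc
      · subst hp
        rw [hsum _ hc, if_neg (Nat.succ_ne_zero c), inv_mul_cancel_left₀ ht, Nat.add_sub_cancel]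
      · subst hp
        refine (famRep_apply_eq_zero w' ?_).symm
        rw [hlt]
        omega
      · exact hWne p hp c
  refine ⟨fun j => LinearEquiv.ofBijective (Θ j) ⟨hinj j, hsurj j⟩, fun j w =>
    famRep_ext fun p c => ?_⟩
  rw [famRep_x_apply]
  change θ (extend k q (j - 1) ((stdRep k q).x j w.1)) p c =
    if 0 < c ∧ c < len' p then θ (extend k q j w.1) p (c - 1) else 0
  have hw := mem_headSub.mp w.2
  by_cases hp : p = t
  · subst hp
    simp only [θ, if_true, extend_x]
    by_cases hc : c + 1 < p.len
    · have h1 : ∑ p', φ p' * (if 0 < c + 1 ∧ c + 1 < p'.len then extend k q j w.1 p' (c + 1 - 1)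
          else 0) = ∑ p', φ p' * extend k q j w.1 p' c := by
        refine Finset.sum_congr rfl fun p' _ => ?_
        by_cases hφp : φ p' = 0
        · rw [hφp, zero_mul, zero_mul]
        · rw [if_pos ⟨Nat.succ_pos c, hc.trans_le (hmin p' hφp)⟩, Nat.add_sub_cancel]
      rw [if_pos hc, h1]
      rcases c with _ | c
      · rw [hw, mul_zero, if_neg (by simp)]
      · rw [if_pos ⟨Nat.succ_pos c, by omega⟩, Nat.add_sub_cancel, if_pos (by omega)]
    · rw [if_neg hc, if_neg (by omega)]
  · simp only [θ, if_neg hp, extend_x, hlp p hp]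

/-- Linear forms on `k[q]` that vanish on the images of the arrows are determined by their
coefficients on the heads. -/
theorem exists_headForm_eq (f : ∀ j, (stdRep k q).V j →ₗ[k] k)
    (hf : ∀ j w, f (j - 1) ((stdRep k q).x j w) = 0) :
    ∃ φ : Copy q → k, (∀ j, f j = headForm φ j) ∧ ∀ p, φ p ≠ 0 → f p.head ≠ 0 := by
  classical
  refine ⟨fun p => f p.head (headVec k p rfl), fun j => ?_,
    fun p hp h => hp (LinearMap.congr_fun h _)⟩
  have hvec (p : Copy q) {j : ZMod n} (hj : p.head = j) :
      f p.head (headVec k p rfl) = f j (headVec k p hj) := by subst hj; rfl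
  have hbasis (a : Cell q j) : f j (basisVec k a) =
      headForm (fun p => f p.head (headVec k p rfl)) j (basisVec k a) := by
    by_cases ha : a.pos = 0
    · have hj : a.1.head = j := by simpa [ha] using a.head_sub_pos
      have : basisVec k a = headVec k a.1 hj := by
        refine extend_injective j (funext fun p => funext fun c => ?_)
        rw [extend_basisVec, extend_headVec, ha]
      rw [this, headForm_headVec, hvec a.1 hj]
    · obtain ⟨j, rfl⟩ : ∃ j', j = j' - 1 := ⟨j + 1, by ring⟩
      have ha0 : 0 < a.pos := Nat.pos_of_ne_zero ha
      have : basisVec k a = (stdRep k q).x j (basisVec k (a.prev ha0)) := by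
        refine extend_injective (j - 1) (funext fun p => funext fun c => ?_)
        rw [extend_x, extend_basisVec, extend_basisVec]
        have h1 : (a.prev ha0).1 = a.1 := rfl
        have h2 : (a.prev ha0).pos = a.pos - 1 := rfl
        rw [h1, h2]
        by_cases hp : p = a.1
        · subst hp
          have := a.pos_lt
          by_cases hc : c = a.pos
          · subst hc
            simp [ha0, this]
          · have : ¬ (0 < c ∧ c - 1 = a.pos - 1) := by omega
            simp only [hc, and_false, if_false, true_and]
            split_ifs <;> first | rfl | omega
        · simp [hp]
      rw [this, hf, headForm_x]
  exact LinearMap.pi_ext' fun a => LinearMap.ext_ring (hbasis a)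

end HeadForms

/-! ### Submodules with simple quotient -/

section SimpleQuotient

variable {n : ℕ} {k : Type} [Field k]

theorem sub_one_ne_self (hn : 2 ≤ n) (i : ZMod n) : i - 1 ≠ i := by
  have : Fact (1 < n) := ⟨hn⟩
  simp

theorem Rep.x_eq_zero_of_finrank (hn : 2 ≤ n) (M : Rep n k) [∀ j, Module.Finite k (M.V j)]
    {i : ZMod n} (h : ∀ j, Module.finrank k (M.V j) = if i = j then 1 else 0) (j : ZMod n)
    (w : M.V j) : M.x j w = 0 := by
  have hsub (j : ZMod n) (hj : i ≠ j) : Subsingleton (M.V j) := by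
    rw [← Module.finrank_zero_iff (R := k), h, if_neg hj]
  by_cases hj : i = j
  · have := hsub (j - 1) (by rw [hj]; exact (sub_one_ne_self hn j).symm)
    exact Subsingleton.elim _ _
  · have := hsub j hj
    rw [Subsingleton.elim w 0, map_zero]

theorem finrank_stdRep (m : Multisegment n) (j : ZMod n) :
    Module.finrank k ((stdRep k m).V j) = dimVec m j :=
  Module.finrank_fintype_fun_eq_card k

/-- A representation is isomorphic to the simple one at `i` if and only if it has the same
dimension: since there are no loops, all arrows act by zero. -/
theorem Rep.iso_simple_iff (hn : 2 ≤ n) (M : Rep n k) [∀ j, Module.Finite k (M.V j)]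
    (i : ZMod n) : M.Iso (stdRep k (Finsupp.single (1, i) 1)) ↔
      ∀ j, Module.finrank k (M.V j) = if i = j then 1 else 0 := by
  have : ∀ j, Module.Finite k ((stdRep k (Finsupp.single ((1, i) : Segment n) 1)).V j) :=
    fun j => inferInstanceAs (Module.Finite k (Cell _ j → k))
  have hS (j) : Module.finrank k ((stdRep k (Finsupp.single ((1, i) : Segment n) 1)).V j) =
      if i = j then 1 else 0 := by rw [finrank_stdRep, dimVec_simple]
  constructor
  · rintro ⟨e, _⟩ j
    rw [(e j).finrank_eq, hS]
  · intro h
    refine ⟨fun j => LinearEquiv.ofFinrankEq _ _ ((h j).trans (hS j).symm), fun j w => ?_⟩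
    rw [M.x_eq_zero_of_finrank hn h, Rep.x_eq_zero_of_finrank hn _ hS, map_zero]

variable {q : Multisegment n}

instance finite_quotient (N : Subrep (stdRep k q)) (j : ZMod n) :
    Module.Finite k (N.quotient.V j) :=
  have : Module.Finite k ((stdRep k q).V j) := inferInstanceAs (Module.Finite k (Cell q j → k))
  inferInstanceAs (Module.Finite k ((stdRep k q).V j ⧸ N.carrier j))

theorem headSub_quotient_iso (hn : 2 ≤ n) {i : ZMod n} {φ : Copy q → k}
    (hφ : ∀ p, φ p ≠ 0 → p.head = i) (h0 : φ ≠ 0) :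
    (headSub φ).quotient.Iso (stdRep k (Finsupp.single (1, i) 1)) := by
  rw [Rep.iso_simple_iff hn]
  intro j
  change Module.finrank k ((stdRep k q).V j ⧸ LinearMap.ker (headForm φ j)) = _
  rw [(LinearMap.quotKerEquivRange (headForm φ j)).finrank_eq]
  split_ifs with hj
  · subst hj
    obtain ⟨p, hp⟩ := Function.ne_iff.mp h0
    have hne : headForm φ i ≠ 0 := fun h => hp (by
      rw [← headForm_headVec φ p (hφ p hp), h]
      rfl)
    rw [LinearMap.range_eq_top.mpr (LinearMap.surjective hne), finrank_top, Module.finrank_self]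
  · have : headForm φ j = 0 := by
      refine LinearMap.ext fun w => ?_
      rw [headForm_apply]
      refine Finset.sum_eq_zero fun p _ => ?_
      by_cases hp : φ p = 0
      · rw [hp, zero_mul]
      · rw [extend_eq_zero, mul_zero]
        rintro ⟨_, h⟩
        exact hj (by rw [← h, hφ p hp]; simp)
    rw [this, LinearMap.range_zero, finrank_bot]

/-- A submodule whose quotient is simple at `i` is the kernel of a nonzero linear form on the heads
at `i`. -/
theorem exists_eq_headSub (hn : 2 ≤ n) {i : ZMod n} (N : Subrep (stdRep k q))
    (hN : N.quotient.Iso (stdRep k (Finsupp.single (1, i) 1))) :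
    ∃ φ : Copy q → k, (∀ p, φ p ≠ 0 → p.head = i) ∧ φ ≠ 0 ∧ N = headSub φ := by
  rw [Rep.iso_simple_iff hn] at hN
  change ∀ j, Module.finrank k ((stdRep k q).V j ⧸ N.carrier j) = _ at hN
  have hfin (j) : Module.Finite k ((stdRep k q).V j ⧸ N.carrier j) := finite_quotient N j
  have htop (j) (hj : i ≠ j) : N.carrier j = ⊤ := by
    rw [← Submodule.Quotient.subsingleton_iff, ← Module.finrank_zero_iff (R := k), hN,
      if_neg hj]
  have hf (j) : ∃ f : (stdRep k q).V j →ₗ[k] k, LinearMap.ker f = N.carrier j := by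
    by_cases hj : i = j
    · let e : ((stdRep k q).V j ⧸ N.carrier j) ≃ₗ[k] k :=
        LinearEquiv.ofFinrankEq _ _ (by rw [hN, if_pos hj, Module.finrank_self])
      exact ⟨e.toLinearMap ∘ₗ (N.carrier j).mkQ, by
        rw [LinearMap.ker_comp, LinearEquiv.ker, Submodule.comap_bot, Submodule.ker_mkQ]⟩
    · exact ⟨0, by rw [LinearMap.ker_zero, htop j hj]⟩
  choose f hf using hf
  have hf0 (j) (hj : i ≠ j) : f j = 0 := by
    rw [← LinearMap.ker_eq_top, hf, htop j hj]
  have hfx (j : ZMod n) (w : (stdRep k q).V j) : f (j - 1) ((stdRep k q).x j w) = 0 := by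
    by_cases hj : i = j - 1
    · rw [← LinearMap.mem_ker, hf]
      refine N.map_mem j w ?_
      rw [htop j (by rw [hj]; exact sub_one_ne_self hn j)]
      trivial
    · rw [hf0 _ hj, LinearMap.zero_apply]
  obtain ⟨φ, hφ, hφ'⟩ := exists_headForm_eq f hfx
  have hNφ : N = headSub φ := Subrep.ext fun j => by
    rw [← hf, hφ]
    rfl
  refine ⟨φ, fun p hp => ?_, ?_, hNφ⟩
  · by_contra h
    exact hφ' p hp (hf0 _ (Ne.symm h))
  · rintro rfl
    have h1 := hN i
    have h2 : N.carrier i = ⊤ := by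
      rw [← hf, hφ, LinearMap.ker_eq_top]
      ext w
      simp [headForm_apply]
    rw [if_pos rfl, h2, Module.finrank_zero_of_subsingleton] at h1
    exact zero_ne_one h1

end SimpleQuotient

/-! ### The Hall numbers -/

section HallNumbers

variable {n : ℕ}

theorem exists_extends (q : Multisegment n) (l : ℕ+) (i : ZMod n) (h : q (l, i) ≠ 0) :
    ∃ m, Extends m l i q := by
  have hle : Finsupp.single (l, i) 1 ≤ q := by
    rw [Finsupp.single_le_iff]
    exact Nat.one_le_iff_ne_zero.mpr h
  by_cases hl : l = 1
  · subst hl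
    exact ⟨q - Finsupp.single (1, i) 1, Or.inl ⟨rfl, (tsub_add_cancel_of_le hle).symm⟩⟩
  · refine ⟨q - Finsupp.single (l, i) 1 + Finsupp.single (l - 1, i - 1) 1, Or.inr
      ⟨lt_of_le_of_ne one_le (Ne.symm hl), ?_⟩⟩
    rw [add_right_comm, tsub_add_cancel_of_le hle]

theorem Extends.apply_eq (hn : 2 ≤ n) {m q : Multisegment n} {l : ℕ+} {i : ZMod n}
    (h : Extends m l i q) (l' : ℕ+) :
    q (l', i) = m (l', i) + if l = l' then 1 else 0 := by
  have h1 := h.segSum_add (fun a b => if a = (l' : ℕ) ∧ b = i then 1 else 0)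
    (by simp [l'.pos.ne])
  have h2 (m : Multisegment n) :
      segSum (fun s => if (s.1 : ℕ) = (l' : ℕ) ∧ s.2 = i then 1 else 0) m = m (l', i) := by
    rw [← segSum_eq_apply]
    congr 2
    funext s
    simp [Prod.ext_iff]
  rw [h2, h2] at h1
  simp only [sub_one_ne_self hn i, and_false, if_false, and_true, sub_zero, PNat.coe_inj] at h1
  exact_mod_cast h1

theorem Extends.length_unique (hn : 2 ≤ n) {m q : Multisegment n} {l l' : ℕ+} {i : ZMod n}
    (h : Extends m l i q) (h' : Extends m l' i q) : l = l' := by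
  have h1 := h.apply_eq hn l
  have h2 := h'.apply_eq hn l
  by_contra hne
  rw [if_pos rfl] at h1
  rw [if_neg (Ne.symm hne)] at h2
  omega

/-- Lengthening a segment to `(l;i]` creates no segment with head at `i` of greater length. -/
theorem Extends.tailCount_succ_eq {m q : Multisegment n} {l : ℕ+} {i : ZMod n}
    (h : Extends m l i q) : tailCount q (l + 1) i = tailCount m (l + 1) i := by
  have h1 := h.segSum_add (fun a b => if b = i ∧ (l : ℕ) + 1 ≤ a then 1 else 0) (by simp)
  rw [if_neg (by omega), if_neg (by omega), add_zero, sub_zero] at h1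
  exact h1

variable {k : Type} [Field k]

/-- The type of `headSub φ` is determined by the shortest segment whose head has non-zero
coefficient. -/
theorem headSub_iso_stdRep {m q : Multisegment n} {i : ZMod n} {φ : Copy q → k}
    (hφ : ∀ p, φ p ≠ 0 → p.head = i) {t : Copy q} (ht : φ t ≠ 0)
    (hmin : ∀ p, φ p ≠ 0 → t.len ≤ p.len) :
    (headSub φ).toRep.Iso (stdRep k m) ↔ Extends m t.1.1.1 i q := by
  constructor
  · intro h
    obtain ⟨m', hm'⟩ := exists_extends q t.1.1.1 i (by
      have := Finsupp.mem_support_iff.mp t.1.2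
      rwa [show t.1.1 = (t.1.1.1, i) from Prod.ext rfl (hφ t ht)] at this)
    have h1 := (headSub_iso hφ ht hmin).trans (hm'.famRep_iso t rfl (hφ t ht))
    rwa [eq_of_stdRep_iso (h.symm.trans h1)]
  · intro h
    exact (headSub_iso hφ ht hmin).trans (h.famRep_iso t rfl (hφ t ht))

theorem exists_min_len {q : Multisegment n} {φ : Copy q → k} (h : φ ≠ 0) :
    ∃ t, φ t ≠ 0 ∧ ∀ p, φ p ≠ 0 → t.len ≤ p.len := by
  classical
  obtain ⟨p, hp⟩ := Function.ne_iff.mp h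
  obtain ⟨t, ht, hmin⟩ := Finset.exists_min_image {p | φ p ≠ 0} Copy.len ⟨p, by simpa using hp⟩
  exact ⟨t, by simpa using ht, fun p hp => hmin p (by simpa using hp)⟩

/-- The number of functions supported on the set where `P` holds. -/
theorem ncard_supported [Finite k] {ι : Type} [Finite ι] (P : ι → Prop) :
    {φ : ι → k | ∀ p, φ p ≠ 0 → P p}.ncard = Nat.card k ^ Nat.card {p // P p} := by
  classical
  have e : {φ : ι → k | ∀ p, φ p ≠ 0 → P p} ≃ ({p // P p} → k) :=
    { toFun := fun φ p => φ.1 p.1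
      invFun := fun z => ⟨fun p => if h : P p then z ⟨p, h⟩ else 0, fun p hp => by
        by_contra h
        exact hp (dif_neg h)⟩
      left_inv := fun φ => Subtype.ext (funext fun p => by
        by_cases h : P p
        · exact dif_pos h
        · refine (dif_neg h).trans ?_
          by_contra h'
          exact h (φ.2 p (Ne.symm h')))
      right_inv := fun z => funext fun p => dif_pos p.2 }
  rw [← Nat.card_coe_set_eq, Nat.card_congr e, Nat.card_fun]

theorem hallCount_eq_zero (hn : 2 ≤ n) {m q : Multisegment n} {i : ZMod n}
    (h : ∀ l, ¬ Extends m l i q) : hallCount k (Finsupp.single (1, i) 1) m q = 0 := by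
  have : IsEmpty {N : Subrep (stdRep k q) // N.toRep.Iso (stdRep k m) ∧
      N.quotient.Iso (stdRep k (Finsupp.single (1, i) 1))} := by
    refine ⟨fun ⟨N, hN1, hN2⟩ => ?_⟩
    obtain ⟨φ, hφ, h0, rfl⟩ := exists_eq_headSub hn N hN2
    obtain ⟨t, ht, hmin⟩ := exists_min_len h0
    exact h _ ((headSub_iso_stdRep hφ ht hmin).mp hN1)
  exact Nat.card_of_isEmpty

/-- A submodule of the required type is the kernel of a linear form on the heads at `i`, unique up
to scalars, such that the shortest segment whose head has non-zero coefficient has length `l`. -/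
theorem Extends.hallCount_mul (hn : 2 ≤ n) [Finite k] {m q : Multisegment n} {l : ℕ+} {i : ZMod n}
    (h : Extends m l i q) :
    hallCount k (Finsupp.single (1, i) 1) m q * (Nat.card k - 1) +
      Nat.card k ^ Nat.card {p : Copy q // p.head = i ∧ (l : ℕ) + 1 ≤ p.len} =
      Nat.card k ^ Nat.card {p : Copy q // p.head = i ∧ (l : ℕ) ≤ p.len} := by
  classical
  set A : Set (Copy q → k) := {φ | ∀ p, φ p ≠ 0 → p.head = i ∧ (l : ℕ) ≤ p.len} with hA
  set B : Set (Copy q → k) := {φ | ∀ p, φ p ≠ 0 → p.head = i ∧ (l : ℕ) + 1 ≤ p.len} with hB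
  have hBA : B ⊆ A := fun φ hφ p hp => ⟨(hφ p hp).1, by have := (hφ p hp).2; omega⟩
  -- The forms whose shortest segment with non-zero coefficient has length `l`.
  have hmem (φ : Copy q → k) : φ ∈ A \ B ↔
      (∀ p, φ p ≠ 0 → p.head = i) ∧ ∃ t, φ t ≠ 0 ∧ t.1.1.1 = l ∧
        ∀ p, φ p ≠ 0 → t.len ≤ p.len := by
    constructor
    · rintro ⟨hφA, hφB⟩
      refine ⟨fun p hp => (hφA p hp).1, ?_⟩
      simp only [hB, Set.mem_ofPred_eq, not_forall] at hφB
      obtain ⟨t, ht, ht'⟩ := hφB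
      have h1 := hφA t ht
      have h2 : t.len = l := by
        by_contra h3
        exact ht' ⟨h1.1, by have := h1.2; omega⟩
      exact ⟨t, ht, PNat.coe_injective h2, fun p hp => h2.le.trans (hφA p hp).2⟩
    · rintro ⟨hφ, t, ht, hl, hmin⟩
      have hl' : t.len = l := congrArg PNat.val hl
      refine ⟨fun p hp => ⟨hφ p hp, hl' ▸ hmin p hp⟩, fun hφB => ?_⟩
      have := (hφB t ht).2
      omega
  have hsub (φ : Copy q → k) (hφ : φ ∈ A \ B) : (headSub φ).toRep.Iso (stdRep k m) ∧
      (headSub φ).quotient.Iso (stdRep k (Finsupp.single (1, i) 1)) := by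
    obtain ⟨h1, t, ht, rfl, hmin⟩ := (hmem φ).mp hφ
    exact ⟨(headSub_iso_stdRep h1 ht hmin).mpr h,
      headSub_quotient_iso hn h1 fun h0 => ht (by rw [h0]; rfl)⟩
  have hex (N : {N : Subrep (stdRep k q) // N.toRep.Iso (stdRep k m) ∧
      N.quotient.Iso (stdRep k (Finsupp.single (1, i) 1))}) :
      ∃ φ ∈ A \ B, N.1 = headSub φ := by
    obtain ⟨N, hN1, hN2⟩ := N
    obtain ⟨φ, hφ, h0, rfl⟩ := exists_eq_headSub hn N hN2
    obtain ⟨t, ht, hmin⟩ := exists_min_len h0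
    have := (headSub_iso_stdRep hφ ht hmin).mp hN1
    exact ⟨φ, (hmem φ).mpr ⟨hφ, t, ht, this.length_unique hn h, hmin⟩, rfl⟩
  choose r hr hNr using hex
  have hsmul (φ : Copy q → k) (hφ : φ ∈ A \ B) (a : kˣ) : (a : k) • φ ∈ A \ B := by
    rw [hmem] at hφ ⊢
    simpa using hφ
  -- Such forms correspond to pairs of a submodule and a scalar.
  let e : {N : Subrep (stdRep k q) // N.toRep.Iso (stdRep k m) ∧
      N.quotient.Iso (stdRep k (Finsupp.single (1, i) 1))} × kˣ → ↥(A \ B) :=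
    fun x => ⟨(x.2 : k) • r x.1, hsmul _ (hr x.1) x.2⟩
  have he : Function.Bijective e := by
    constructor
    · rintro ⟨N, a⟩ ⟨N', a'⟩ hx
      have hx' : (a : k) • r N = (a' : k) • r N' := congrArg Subtype.val hx
      have hN : N = N' := by
        refine Subtype.ext ?_
        rw [hNr N, hNr N', ← headSub_smul (r N) a.ne_zero, hx', headSub_smul _ a'.ne_zero]
      subst hN
      obtain ⟨_, t, ht, _⟩ := (hmem _).mp (hr N)
      have := congrFun hx' t
      simp only [Pi.smul_apply, smul_eq_mul] at this
      rw [Units.ext (mul_right_cancel₀ ht this)]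
    · rintro ⟨φ, hφ⟩
      let N : {N : Subrep (stdRep k q) // N.toRep.Iso (stdRep k m) ∧
        N.quotient.Iso (stdRep k (Finsupp.single (1, i) 1))} := ⟨headSub φ, hsub φ hφ⟩
      obtain ⟨h1, t, ht, _⟩ := (hmem _).mp (hr N)
      obtain ⟨h2, t', ht', _⟩ := (hmem _).mp hφ
      have h3 := eq_smul_of_headSub_eq h1 h2 ht (hNr N).symm
      have h4 : φ t / r N t ≠ 0 := fun h0 => ht' (by rw [h3, h0, zero_smul]; rfl)
      exact ⟨(N, Units.mk0 _ h4), Subtype.ext h3.symm⟩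
  have hcard := Nat.card_eq_of_bijective e he
  rw [Nat.card_prod, Nat.card_units, Nat.card_coe_set_eq] at hcard
  rw [← ncard_supported (k := k), ← ncard_supported (k := k), hallCount, hcard]
  exact Set.ncard_sdiff_add_ncard_of_subset hBA

/-- The Hall polynomial of an extension of `k[m]` by a simple module. -/
theorem Extends.hallPoly_eq (hn : 2 ≤ n) {m q : Multisegment n} {l : ℕ+} {i : ZMod n}
    (h : Extends m l i q) {B : ℕ} (hB : (B : ℤ) = tailCount m (l + 1) i) :
    hallPoly (Finsupp.single (1, i) 1) m q =
      Polynomial.X ^ B * ∑ r ∈ Finset.range (m (l, i) + 1), Polynomial.X ^ r := by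
  have hP : IsHallPoly (Finsupp.single (1, i) 1) m q
      (Polynomial.X ^ B * ∑ r ∈ Finset.range (m (l, i) + 1), Polynomial.X ^ r) := by
    intro k _ _
    have h1 := h.hallCount_mul (k := k) hn
    have hk : 1 < Nat.card k := Finite.one_lt_card
    have h2 : Nat.card {p : Copy q // p.head = i ∧ (l : ℕ) + 1 ≤ p.len} = B := by
      have := tailCount_eq_card q (l + 1) i
      rw [h.tailCount_succ_eq, ← hB] at this
      exact_mod_cast this.symm
    have h3 : Nat.card {p : Copy q // p.head = i ∧ (l : ℕ) ≤ p.len} = B + (m (l, i) + 1) := by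
      have h4 := tailCount_eq_card q l i
      rw [tailCount_eq, h.tailCount_succ_eq, ← hB, h.apply_eq hn, if_pos rfl] at h4
      have : ((B + (m (l, i) + 1) : ℕ) : ℤ) =
          Nat.card {p : Copy q // p.head = i ∧ (l : ℕ) ≤ p.len} := by
        rw [← h4]
        push_cast
        ring
      exact_mod_cast this.symm
    rw [h2, h3] at h1
    have h5 : (hallCount k (Finsupp.single (1, i) 1) m q : ℤ) * ((Nat.card k : ℤ) - 1) +
        (Nat.card k : ℤ) ^ B = (Nat.card k : ℤ) ^ (B + (m (l, i) + 1)) := by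
      have := congrArg (Nat.cast (R := ℤ)) h1
      push_cast [Nat.cast_sub hk.le] at this
      exact this
    have h6 := geom_sum_mul (Nat.card k : ℤ) (m (l, i) + 1)
    have h7 : (Nat.card k : ℤ) - 1 ≠ 0 := by
      have : (1 : ℤ) < Nat.card k := by exact_mod_cast hk
      omega
    refine mul_right_cancel₀ h7 ?_
    simp only [Polynomial.eval_mul, Polynomial.eval_pow, Polynomial.eval_X,
      Polynomial.eval_finsetSum]
    rw [mul_assoc, h6]
    rw [pow_add] at h5
    linarith
  have hex : ∃ F, IsHallPoly (Finsupp.single (1, i) 1) m q F := ⟨_, hP⟩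
  rw [hallPoly, dif_pos hex]
  exact hex.choose_spec.unique hP

theorem hallPoly_eq_zero (hn : 2 ≤ n) {m q : Multisegment n} {i : ZMod n}
    (h : ∀ l, ¬ Extends m l i q) : hallPoly (Finsupp.single (1, i) 1) m q = 0 := by
  have hP : IsHallPoly (Finsupp.single (1, i) 1) m q 0 := by
    intro k _ _
    rw [hallCount_eq_zero hn h]
    simp
  have hex : ∃ F, IsHallPoly (Finsupp.single (1, i) 1) m q F := ⟨_, hP⟩
  rw [hallPoly, dif_pos hex]
  exact hex.choose_spec.unique hP

end HallNumbers

/-! ### Comparison of coefficients -/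

section Coefficients

variable {n : ℕ}

theorem tailCount_eq_zero {m : Multisegment n} {l : ℕ} (i : ZMod n)
    (h : ∀ s ∈ m.support, (s.1 : ℕ) < l) : tailCount m l i = 0 := by
  rw [tailCount, segSum, Finsupp.linearCombination_apply]
  refine Finset.sum_eq_zero fun s hs => ?_
  dsimp only
  rw [if_neg fun h' => (h s hs).not_ge h'.2, smul_zero]

/-- The telescoping sum behind `exponent_eq`. -/
theorem sum_Ioc_eq_tailCount (m : Multisegment n) (l L : ℕ+) (hL : l ≤ L) (i : ZMod n) :
    ∑ k ∈ Finset.Ioc l L, ((m (k - 1, i - 1) : ℤ) - (m (k, i) : ℤ)) =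
      (tailCount m l (i - 1) - tailCount m (l + 1) i) -
        (tailCount m L (i - 1) - tailCount m (L + 1) i) := by
  induction L using PNat.recOn with
  | one =>
    obtain rfl : l = 1 := le_antisymm hL one_le
    simp
  | succ L ih =>
    rcases hL.eq_or_lt with rfl | hlt
    · simp
    · have hlL : l ≤ L := PNat.lt_add_one_iff.mp hlt
      have hI : Finset.Ioc l (L + 1) = insert (L + 1) (Finset.Ioc l L) := by
        ext k
        simp only [Finset.mem_Ioc, Finset.mem_insert, ← PNat.coe_le_coe, ← PNat.coe_lt_coe,
          ← PNat.coe_inj, PNat.add_coe, PNat.one_coe] at hlt ⊢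
        omega
      rw [hI, Finset.sum_insert (by simp), ih hlL]
      have h1 := tailCount_eq m L (i - 1)
      have h2 := tailCount_eq m (L + 1) i
      rw [show L + 1 - 1 = L from PNat.eq (by simp)]
      push_cast at h2 ⊢
      linarith

/-- The exponent of `v` as a difference of numbers of segments. -/
theorem exponent_eq (m : Multisegment n) (l : ℕ+) (i : ZMod n) :
    exponent m l i = tailCount m l (i - 1) - tailCount m (l + 1) i := by
  classical
  obtain ⟨L, hlL, hL⟩ : ∃ L : ℕ+, l ≤ L ∧ ∀ s ∈ m.support, s.1 < L := by
    obtain ⟨L, hL⟩ : ∃ L : ℕ+, (L : ℕ) = l + ∑ s ∈ m.support, (s.1 : ℕ) :=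
      ⟨Nat.toPNat _ (Nat.add_pos_left l.pos _), rfl⟩
    refine ⟨L, ?_, fun s hs => ?_⟩
    · rw [← PNat.coe_le_coe, hL]
      exact Nat.le_add_right _ _
    · rw [← PNat.coe_lt_coe, hL]
      exact lt_add_of_pos_of_le l.pos (Finset.single_le_sum (f := fun s : Segment n => (s.1 : ℕ))
        (fun _ _ => Nat.zero_le _) hs)
  have h0 (k : ℕ+) (hk : L ≤ k) (i : ZMod n) : m (k, i) = 0 := by
    by_contra h
    exact (hL _ (Finsupp.mem_support_iff.mpr h)).not_ge hk
  have hL' : ∀ s ∈ m.support, (s.1 : ℕ) < (L : ℕ) := fun s hs =>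
    PNat.coe_lt_coe _ _ |>.mpr (hL s hs)
  rw [exponent, finsum_mem_eq_sum_of_inter_support_eq (t := Finset.Ioc l L),
    sum_Ioc_eq_tailCount m l L hlL, tailCount_eq_zero _ hL',
    tailCount_eq_zero _ fun s hs => (hL' s hs).trans (Nat.lt_succ_self _)]
  · ring
  · ext k
    simp only [Set.mem_inter_iff, Set.mem_Ioi, Function.mem_support, Finset.coe_Ioc, Set.mem_Ioc]
    refine and_congr_left fun hk => ⟨fun h => ⟨h, ?_⟩, fun h => h.1⟩
    by_contra hkL
    rw [not_le] at hkL
    apply hk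
    have h1 : L ≤ k - 1 := by
      have := PNat.sub_add_of_lt (lt_of_le_of_lt one_le hkL)
      rw [← PNat.lt_add_one_iff, this]
      exact hkL
    rw [h0 _ h1, h0 _ hkL.le]
    simp

theorem v_ne_zero : v ≠ 0 := RatFunc.X_ne_zero

theorem v_sub_inv_ne_zero : v - v⁻¹ ≠ 0 := by
  intro h
  have h1 : v * v = 1 := by
    have h2 : v = v⁻¹ := sub_eq_zero.mp h
    nth_rewrite 2 [h2]
    exact mul_inv_cancel₀ v_ne_zero
  rw [v, ← RatFunc.algebraMap_X, ← map_mul, ← map_one (algebraMap ℂ[X] (RatFunc ℂ))] at h1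
  have h3 := RatFunc.algebraMap_injective ℂ h1
  have := congrArg (Polynomial.eval 0) h3
  simp at this

/-- The quantum integer `[a + 1]` is the value of `1 + t + ⋯ + t ^ a` at `t = v⁻²`, up to a power
of `v`. -/
theorem sum_inv_pow_eq_vInt (a : ℕ) :
    ∑ r ∈ Finset.range (a + 1), ((v ^ 2)⁻¹ : RatFunc ℂ) ^ r = v ^ (-(a : ℤ)) * vInt (a + 1) := by
  have hv := v_ne_zero
  have h1 : (1 : RatFunc ℂ) - (v ^ 2)⁻¹ = v⁻¹ * (v - v⁻¹) := by
    field_simp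
  have h2 : (1 : RatFunc ℂ) - (v ^ 2)⁻¹ ≠ 0 := by
    rw [h1]
    exact mul_ne_zero (inv_ne_zero hv) v_sub_inv_ne_zero
  refine mul_right_cancel₀ h2 ?_
  rw [geom_sum_mul_neg, h1, vInt]
  have h3 : v ^ (-(a : ℤ)) * ((v ^ ((a : ℤ) + 1) - v ^ (-((a : ℤ) + 1))) / (v - v⁻¹)) *
      (v⁻¹ * (v - v⁻¹)) =
      v ^ (-(a : ℤ)) * v ^ (-1 : ℤ) * (v ^ ((a : ℤ) + 1) - v ^ (-((a : ℤ) + 1))) := by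
    have := v_sub_inv_ne_zero
    rw [zpow_neg_one]
    generalize v - v⁻¹ = d at this
    field_simp
  rw [h3, mul_sub, ← zpow_add₀ hv, ← zpow_add₀ hv, ← zpow_add₀ hv,
    show -(a : ℤ) + -1 + (a + 1) = 0 by ring, zpow_zero,
    show -(a : ℤ) + -1 + -(a + 1) = -((2 * (a + 1) : ℕ) : ℤ) by push_cast; ring, zpow_neg,
    zpow_natCast, pow_mul, inv_pow]

variable [NeZero n]

/-- The coefficient of `⟨q⟩` in `f_i ⟨m⟩`, for `q` obtained from `m` by lengthening a segment. -/
theorem Extends.coefficient_eq (hn : 2 ≤ n) {m q : Multisegment n} {l : ℕ+} {i : ZMod n}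
    (h : Extends m l i q) :
    v ^ orbitDim m * (v ^ mForm (dimVec (Finsupp.single ((1, i) : Segment n) 1)) (dimVec m) *
      Polynomial.aeval ((v ^ 2)⁻¹ : RatFunc ℂ) (hallPoly (Finsupp.single (1, i) 1) m q)) =
    v ^ exponent m l i * vInt ((m (l, i) : ℤ) + 1) * v ^ orbitDim q := by
  have hv := v_ne_zero
  obtain ⟨B, hB⟩ : ∃ B : ℕ, (B : ℤ) = tailCount m (l + 1) i :=
    ⟨_, (tailCount_eq_card m (l + 1) i).symm⟩
  have hm : mForm (dimVec (Finsupp.single ((1, i) : Segment n) 1)) (dimVec m) =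
      dimVec m (i - 1) + dimVec m i := by
    simp [mForm, dimVec_simple]
  have ho := h.orbitDim_eq
  rw [tailCount_eq m l i, ← hB] at ho
  rw [h.hallPoly_eq hn hB, hm, exponent_eq, ← hB]
  simp only [map_mul, map_pow, map_sum, Polynomial.aeval_X]
  rw [sum_inv_pow_eq_vInt]
  have h1 : ((v ^ 2)⁻¹ : RatFunc ℂ) ^ B = v ^ (-(2 * B : ℤ)) := by
    rw [inv_pow, ← pow_mul, zpow_neg]
    norm_cast
  rw [h1, ← zpow_natCast v (orbitDim m), ← zpow_natCast v (orbitDim q), ← zpow_natCast v (_ + _)]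
  have h2 : v ^ (orbitDim m : ℤ) * (v ^ ((dimVec m (i - 1) + dimVec m i : ℕ) : ℤ) *
      (v ^ (-(2 * B : ℤ)) * (v ^ (-(m (l, i) : ℤ)) * vInt (m (l, i) + 1)))) =
      v ^ ((orbitDim m : ℤ) + (dimVec m (i - 1) + dimVec m i : ℕ) + -(2 * B : ℤ) +
        -(m (l, i) : ℤ)) * vInt (m (l, i) + 1) := by
    rw [zpow_add₀ hv, zpow_add₀ hv, zpow_add₀ hv]
    ring
  have h3 : v ^ (tailCount m l (i - 1) - B) * vInt (m (l, i) + 1) * v ^ (orbitDim q : ℤ) =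
      v ^ (tailCount m l (i - 1) - B + orbitDim q) * vInt (m (l, i) + 1) := by
    rw [zpow_add₀ hv]
    ring
  rw [h2, h3, ho]
  congr 2
  push_cast
  ring

end Coefficients

/-! ### The action of the Chevalley generators -/

section Action

variable {n : ℕ}

/-- The multisegment `m + (l;i] - (l-1;i-1]`, respectively `m + (1;i]` for `l = 1`. -/
def lengthen (m : Multisegment n) (l : ℕ+) (i : ZMod n) : Multisegment n :=
  if l = 1 then m + Finsupp.single (1, i) 1
  else m + Finsupp.single (l, i) 1 - Finsupp.single (l - 1, i - 1) 1

theorem extends_lengthen {m : Multisegment n} {l : ℕ+} {i : ZMod n}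
    (h : l = 1 ∨ 1 < l ∧ m (l - 1, i - 1) ≠ 0) : Extends m l i (lengthen m l i) := by
  rcases h with rfl | ⟨hl, hm⟩
  · exact Or.inl ⟨rfl, if_pos rfl⟩
  · refine Or.inr ⟨hl, ?_⟩
    rw [lengthen, if_neg hl.ne', tsub_add_cancel_of_le]
    refine le_add_right ?_
    rw [Finsupp.single_le_iff]
    exact Nat.one_le_iff_ne_zero.mpr hm

theorem Extends.eq_lengthen (hn : 2 ≤ n) {m q : Multisegment n} {l : ℕ+} {i : ZMod n}
    (h : Extends m l i q) : (l = 1 ∨ 1 < l ∧ m (l - 1, i - 1) ≠ 0) ∧ q = lengthen m l i := by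
  rcases h with ⟨rfl, rfl⟩ | ⟨hl, h⟩
  · exact ⟨Or.inl rfl, (if_pos rfl).symm⟩
  · refine ⟨Or.inr ⟨hl, fun hm => ?_⟩, ?_⟩
    · have h1 := DFunLike.congr_fun h (l - 1, i - 1)
      rw [Finsupp.add_apply, Finsupp.add_apply, Finsupp.single_eq_same,
        Finsupp.single_eq_of_ne fun h' => sub_one_ne_self hn i (congrArg Prod.snd h'), hm] at h1
      omega
    · rw [lengthen, if_neg hl.ne', ← h, add_tsub_cancel_right]

variable [NeZero n]

theorem chevalleyF_pbw (i : ZMod n) (m : Multisegment n) :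
    chevalleyF i (pbw m) = v ^ orbitDim m • basisMul (Finsupp.single (1, i) 1) m := by
  rw [chevalleyF, pbw, pbw, orbitDim_simple, pow_zero, one_smul, map_smul, hallMul, u, u,
    Finsupp.linearCombination_single, one_smul, Finsupp.linearCombination_single, one_smul]

end Action

end CyclicHall
end

theorem proposition4p1 (n : ℕ) [NeZero n] (hn : 2 ≤ n) (i : ZMod n)
    (m : CyclicHall.Multisegment n) :
    CyclicHall.chevalleyF i (CyclicHall.pbw m) =
      ∑ᶠ l : ℕ+,
        (CyclicHall.v ^ CyclicHall.exponent m l i * CyclicHall.vInt ((m (l, i) : ℤ) + 1)) •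
          CyclicHall.pbwPlus m l i := by
  classical
  open CyclicHall in
  set Λ : Set ℕ+ := {l | l = 1 ∨ 1 < l ∧ m (l - 1, i - 1) ≠ 0} with hΛ
  have hfin : Λ.Finite := by
    refine (Set.Finite.union (Set.finite_singleton 1)
      (finite_apply_pred_ne_zero m (i - 1))).subset fun l hl => hl
  have hplus (l : ℕ+) (hl : l ∈ hfin.toFinset) : pbwPlus m l i = pbw (lengthen m l i) := by
    have hl' : l = 1 ∨ 1 < l ∧ m (l - 1, i - 1) ≠ 0 := by simpa [hΛ] using hl
    rw [pbwPlus, lengthen]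
    by_cases h1 : l = 1
    · rw [if_pos h1, if_pos h1]
    · rw [if_neg h1, if_neg h1, if_neg (hl'.resolve_left h1).2]
  have hext (l : ℕ+) (hl : l ∈ hfin.toFinset) : Extends m l i (lengthen m l i) :=
    extends_lengthen (by simpa [hΛ] using hl)
  rw [finsum_eq_sum_of_support_subset (s := hfin.toFinset), chevalleyF_pbw, basisMul]
  · rw [← Finset.sum_subset (s₁ := hfin.toFinset.image fun l => lengthen m l i)]
    · rw [Finset.sum_image fun l hl l' hl' h => (hext l hl).length_unique hn (by
        change lengthen m l i = lengthen m l' i at h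
        rw [h]
        exact hext l' hl'), Finset.smul_sum, Finset.smul_sum]
      refine Finset.sum_congr rfl fun l hl => ?_
      rw [hplus l hl, pbw, smul_smul, smul_smul, smul_smul, mul_assoc,
        (hext l hl).coefficient_eq hn]
    · intro q hq
      obtain ⟨l, hl, rfl⟩ := Finset.mem_image.mp hq
      rw [Set.Finite.mem_toFinset, Set.mem_ofPred_eq]
      funext j
      rw [(hext l hl).dimVec_eq, Pi.add_apply, dimVec_simple, add_comm]
    · intro q _ hq
      rw [hallPoly_eq_zero hn, map_zero, zero_smul]
      intro l hl
      obtain ⟨h1, rfl⟩ := hl.eq_lengthen hn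
      exact hq (Finset.mem_image.mpr ⟨l, hfin.mem_toFinset.mpr h1, rfl⟩)
  · intro l hl
    rw [Set.Finite.coe_toFinset]
    by_contra h
    simp only [hΛ, Set.mem_ofPred_eq, not_or, not_and, not_not] at h
    refine hl (smul_eq_zero_of_right _ ?_)
    rw [pbwPlus, if_neg h.1, if_pos (h.2 (lt_of_le_of_ne one_le (Ne.symm h.1)))]
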